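/- All channels are finite-dimensional: a channel $\Phi$ from a space $H_A$ to a space $H_B$ is a completely positive trace-preserving linear map. If $\Phi(\rho)=\mathrm{Tr}_{H_E}V\rho V^*$ with an isometry $V:H_A\to H_B\otimes H_E$, the complementary channel is $\widehat\Phi(\rho)=\mathrm{Tr}_{H_B}V\rho V^*$, and the noncommutative graph of $\Phi$ is $\mathcal G(\Phi)=\widehat\Phi^*(B(H_E))\subseteq B(H_A)$, where $\widehat\Phi^*$ is the dual map of $\widehat\Phi$ (it does not depend on the choice of $V$). A subspace $H_0\subseteq H_A$ is an error-correcting code for $\Phi$ if there is a channel $\Theta$ with $\Theta(\Phi(\rho))=\rho$ for all states $\rho$ supported by $H_0$. The 1-shot quantum zero-error capacity is $\bar Q_0(\Phi)=\sup\log_2\dim H_0$ over all nonzero error-correcting codes $H_0$ for $\Phi$. For $\theta\in(-\pi,\pi]$ put $\gamma=e^{i\theta/2}$ and $$\mathfrak L_\theta=\left\{\begin{pmatrix} a&b&\gamma c&d\\ b&a&d&\bar\gamma c\\ \bar\gamma c&d&a&b\\ d&\gamma c&b&a\end{pmatrix}: a,b,c,d\in\mathbb C\right\},\qquad W_4=\begin{pmatrix}0&0&0&1\\0&0&1&0\\0&1&0&0\\1&0&0&0\end{pmatrix}.$$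 **Theorem.** (A) Let $\theta\in(-\pi,\pi]$ and let $\Phi_\theta$ be any channel with input space $\mathbb C^4$ and $\mathcal G(\Phi_\theta)=\mathfrak L_\theta$. Then $\bar Q_0(\Phi_\theta)>0$ if and only if $\theta=\pi$, and $\bar Q_0(\Phi_\pi)=1$. Now let $n\in\mathbb N$, $\theta_1,\dots,\theta_n\in(-\pi,\pi]$, and for each $k$ let $\Phi_{\theta_k}$ be any channel with input space $\mathbb C^4$ and $\mathcal G(\Phi_{\theta_k})=\mathfrak L_{\theta_k}$. (B) If $\theta_1+\dots+\theta_n\equiv\pi\pmod{2\pi}$, then $\bar Q_0(\Phi_{\theta_1}\otimes\dots\otimes\Phi_{\theta_n})>0$ and $\Phi_{\theta_1}\otimes\dots\otimes\Phi_{\theta_n}$ has $2^n$ mutually orthogonal 2-dimensional error-correcting codes, namely: for each binary $n$-tuple $(x_1,\dots,x_n)$, the span of the images of $$|\varphi\rangle=\tfrac1{\sqrt2}\bigl(|1\dots1\rangle+i|2\dots2\rangle\bigr),\qquad |\psi\rangle=\tfrac1{\sqrt2}\bigl(|3\dots3\rangle+i|4\dots4\rangle\bigr)$$ under $U_{x_1}\otimes\dots\otimes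 U_{x_n}$, where $|1\rangle,\dots,|4\rangle$ is the canonical basis of $\mathbb C^4$, $U_0=I_4$ and $U_1=W_4$. (C) If $|\theta_1|+\dots+|\theta_n|\le 2\ln(3/2)$, then $\bar Q_0(\Phi_{\theta_1}\otimes\dots\otimes\Phi_{\theta_n})=0$. -/

import Mathlib

open scoped ComplexOrder Matrix Kronecker

universe u

noncomputable section

namespace QZero

/-! ### Channels between full matrix algebras

The finite-dimensional Hilbert space with orthonormal basis indexed by `α` is
`EuclideanSpace ℂ α`, and the operators on it are `Matrix α α ℂ`. -/

/-- The map `id ⊗ Φ` on `κ × κ` block matrices: `Φ` is applied to every block. -/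
def amplify {α β : Type*} (κ : Type*) (Φ : Matrix α α ℂ →ₗ[ℂ] Matrix β β ℂ)
    (X : Matrix (κ × α) (κ × α) ℂ) : Matrix (κ × β) (κ × β) ℂ :=
  Matrix.of fun p q => Φ (Matrix.of fun a a' => X (p.1, a) (q.1, a')) p.2 q.2

/-- Complete positivity. -/
def IsCompletelyPositive {α β : Type*} (Φ : Matrix α α ℂ →ₗ[ℂ] Matrix β β ℂ) : Prop :=
  ∀ (k : ℕ) (X : Matrix (Fin k × α) (Fin k × α) ℂ),
    X.PosSemidef → (amplify (Fin k) Φ X).PosSemidef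

/-- Quantum channels: completely positive trace preserving linear maps. -/
def IsChannel {α β : Type*} [Fintype α] [Fintype β]
    (Φ : Matrix α α ℂ →ₗ[ℂ] Matrix β β ℂ) : Prop :=
  IsCompletelyPositive Φ ∧ ∀ X, (Φ X).trace = X.trace

/-- Quantum states: positive operators of unit trace. -/
def IsState {α : Type*} [Fintype α] (ρ : Matrix α α ℂ) : Prop :=
  ρ.PosSemidef ∧ ρ.trace = 1

/-- The operator `ρ` is supported by the subspace `K`, that is, its range lies in `K`. -/
def SupportedBy {α : Type*} [Fintype α] [DecidableEq α] (ρ : Matrix α α ℂ)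
    (K : Submodule ℂ (EuclideanSpace ℂ α)) : Prop :=
  LinearMap.range ρ.toEuclideanLin ≤ K

/-- `K` is an error correcting code for `Φ`: some channel `Θ` satisfies `Θ (Φ ρ) = ρ` for all
states `ρ` supported by `K`. -/
def IsErrorCorrectingCode {α β : Type*} [Fintype α] [DecidableEq α] [Fintype β]
    (Φ : Matrix α α ℂ →ₗ[ℂ] Matrix β β ℂ) (K : Submodule ℂ (EuclideanSpace ℂ α)) : Prop :=
  ∃ Θ : Matrix β β ℂ →ₗ[ℂ] Matrix α α ℂ, IsChannel Θ ∧
    ∀ ρ, IsState ρ → SupportedBy ρ K → Θ (Φ ρ) = ρ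

/-- The 1-shot quantum zero-error capacity: the supremum of `log₂ (dim K)` over the (nonzero)
error correcting codes `K`. The set is bounded by `log₂` of the input dimension. -/
def oneShotCapacity {α β : Type*} [Fintype α] [DecidableEq α] [Fintype β]
    (Φ : Matrix α α ℂ →ₗ[ℂ] Matrix β β ℂ) : ℝ :=
  sSup {r : ℝ | ∃ K : Submodule ℂ (EuclideanSpace ℂ α), K ≠ ⊥ ∧ IsErrorCorrectingCode Φ K ∧
    r = Real.logb 2 (Module.finrank ℂ K)}

/-! ### Complementary channels and noncommutative graphs -/

/-- The partial trace over the second tensor factor. -/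
def traceRight {β ε : Type*} [Fintype ε] (X : Matrix (β × ε) (β × ε) ℂ) : Matrix β β ℂ :=
  Matrix.of fun b b' => ∑ e, X (b, e) (b', e)

/-- The partial trace over the first tensor factor. -/
def traceLeft {β ε : Type*} [Fintype β] (X : Matrix (β × ε) (β × ε) ℂ) : Matrix ε ε ℂ :=
  Matrix.of fun e e' => ∑ b, X (b, e) (b, e')

/-- `V : H_A → H_B ⊗ H_E` is an isometry with `Φ ρ = Tr_E (V ρ V*)`. -/
def IsStinespring {α β ε : Type*} [Fintype α] [DecidableEq α] [Fintype β] [Fintype ε]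
    (Φ : Matrix α α ℂ →ₗ[ℂ] Matrix β β ℂ) (V : Matrix (β × ε) α ℂ) : Prop :=
  Vᴴ * V = 1 ∧ ∀ ρ, Φ ρ = traceRight (V * ρ * Vᴴ)

/-- The channel `ρ ↦ Tr_B (V ρ V*)`, which is complementary to `ρ ↦ Tr_E (V ρ V*)`. -/
def complementary {α β ε : Type*} [Fintype α] [Fintype β]
    (V : Matrix (β × ε) α ℂ) : Matrix α α ℂ →ₗ[ℂ] Matrix ε ε ℂ where
  toFun ρ := traceLeft (V * ρ * Vᴴ)
  map_add' ρ σ := by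
    ext e e'
    simp [traceLeft, Matrix.mul_add, Matrix.add_mul, Finset.sum_add_distrib]
  map_smul' c ρ := by
    ext e e'
    simp [traceLeft, Finset.mul_sum]

/-- The dual map `Ψ*`, determined by `Tr (ρ Ψ*(X)) = Tr (Ψ(ρ) X)`; its `(i, j)` entry is obtained
by taking for `ρ` the matrix unit at `(j, i)`. -/
def dualMap {α ε : Type*} [DecidableEq α] [Fintype ε]
    (Ψ : Matrix α α ℂ →ₗ[ℂ] Matrix ε ε ℂ) (X : Matrix ε ε ℂ) : Matrix α α ℂ :=
  Matrix.of fun i j => (Ψ (Matrix.single j i 1) * X).trace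

theorem trace_mul_dualMap {α ε : Type*} [Fintype α] [DecidableEq α] [Fintype ε]
    (Ψ : Matrix α α ℂ →ₗ[ℂ] Matrix ε ε ℂ) (X : Matrix ε ε ℂ) (ρ : Matrix α α ℂ) :
    (ρ * dualMap Ψ X).trace = (Ψ ρ * X).trace := by
  have h : ρ = ∑ i, ∑ j, ρ i j • Matrix.single i j (1 : ℂ) := by
    conv_lhs => rw [Matrix.matrix_eq_sum_single ρ]
    simp [Matrix.smul_single]
  conv_rhs => rw [h]
  simp only [map_sum, map_smul, Finset.sum_mul, Matrix.trace_sum, Matrix.smul_mul,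
    Matrix.trace_smul, smul_eq_mul]
  simp [Matrix.trace, Matrix.mul_apply, dualMap]

/-- `L` is the noncommutative graph of `Φ`: the set of all `Ψ*(X)`, where `Ψ` is a channel
complementary to `Φ` and `X` runs over all operators on the environment space. The graph does not
depend on the choice of the Stinespring isometry `V`. -/
def IsNoncommutativeGraph {α β : Type*} [Fintype α] [DecidableEq α] [Fintype β]
    (Φ : Matrix α α ℂ →ₗ[ℂ] Matrix β β ℂ) (L : Set (Matrix α α ℂ)) : Prop :=
  ∃ (m : ℕ) (V : Matrix (β × Fin m) α ℂ),
    IsStinespring Φ V ∧ L = Set.range (dualMap (complementary V))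

/-! ### Tensor products of finitely many operators and of finitely many channels -/

/-- The tensor product of a family of operators. -/
def tensorMatrix {ι : Type*} [Fintype ι] {α : ι → Type*}
    (X : ∀ k, Matrix (α k) (α k) ℂ) : Matrix (∀ k, α k) (∀ k, α k) ℂ :=
  Matrix.of fun p q => ∏ k, X k (p k) (q k)

/-- The tensor product of a family of channels: the linear map that sends the matrix unit at
`(i, j)` to the tensor product of the images of the matrix units at `(i k, j k)`. -/
def tensorChannel {ι : Type*} [Fintype ι] [DecidableEq ι] {α β : ι → Type*}
    [∀ k, Fintype (α k)] [∀ k, DecidableEq (α k)]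
    (Φ : ∀ k, Matrix (α k) (α k) ℂ →ₗ[ℂ] Matrix (β k) (β k) ℂ) :
    Matrix (∀ k, α k) (∀ k, α k) ℂ →ₗ[ℂ] Matrix (∀ k, β k) (∀ k, β k) ℂ where
  toFun X := ∑ i, ∑ j, X i j • tensorMatrix fun k => Φ k (Matrix.single (i k) (j k) 1)
  map_add' X Y := by
    simp [add_smul, Finset.sum_add_distrib]
  map_smul' c X := by
    simp [mul_smul, Finset.smul_sum]

theorem tensorChannel_tensorMatrix {ι : Type*} [Fintype ι] [DecidableEq ι] {α β : ι → Type*}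
    [∀ k, Fintype (α k)] [∀ k, DecidableEq (α k)]
    (Φ : ∀ k, Matrix (α k) (α k) ℂ →ₗ[ℂ] Matrix (β k) (β k) ℂ)
    (X : ∀ k, Matrix (α k) (α k) ℂ) :
    tensorChannel Φ (tensorMatrix X) = tensorMatrix fun k => Φ k (X k) := by
  have h : ∀ k, Φ k (X k) = ∑ i, ∑ j, X k i j • Φ k (Matrix.single i j (1 : ℂ)) := by
    intro k
    conv_lhs => rw [Matrix.matrix_eq_sum_single (X k)]
    simp only [map_sum, ← map_smul, Matrix.smul_single, smul_eq_mul, mul_one]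
  ext p q
  simp only [tensorChannel, LinearMap.coe_mk, AddHom.coe_mk, tensorMatrix, Matrix.of_apply,
    Matrix.sum_apply, Matrix.smul_apply, smul_eq_mul, h, Finset.prod_univ_sum,
    Fintype.piFinset_univ, Finset.prod_mul_distrib]

/-! ### The subspaces `𝔏_θ` and the explicit codes

The canonical basis vectors `|1⟩, |2⟩, |3⟩, |4⟩` of `ℂ⁴` have the indices `0, 1, 2, 3`. -/

/-- `γ = exp (i θ / 2)`. -/
def gam (θ : ℝ) : ℂ := Complex.exp (Complex.I / 2 * θ)

/-- The subspace `𝔏_θ` of the `4 × 4` matrices. -/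
def graphL (θ : ℝ) : Set (Matrix (Fin 4) (Fin 4) ℂ) :=
  {M | ∃ a b c d : ℂ, M =
    !![a,                b,          gam θ * c, d;
       b,                a,          d,         star (gam θ) * c;
       star (gam θ) * c, d,          a,         b;
       d,                gam θ * c,  b,         a]}

/-- The channels with input space `ℂ⁴` whose noncommutative graph is `𝔏_θ`. -/
def InClassL {β : Type*} [Fintype β] (θ : ℝ)
    (Φ : Matrix (Fin 4) (Fin 4) ℂ →ₗ[ℂ] Matrix β β ℂ) : Prop :=
  IsChannel Φ ∧ IsNoncommutativeGraph Φ (graphL θ)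

/-- The unitary matrix `W₄`. -/
def W4 : Matrix (Fin 4) (Fin 4) ℂ :=
  !![0, 0, 0, 1;
     0, 0, 1, 0;
     0, 1, 0, 0;
     1, 0, 0, 0]

/-- `U₀ = I₄`, `U₁ = W₄`. -/
def U : Fin 2 → Matrix (Fin 4) (Fin 4) ℂ := ![1, W4]

/-- `(|p … p⟩ + i |q … q⟩) / √2` in the `n`-fold tensor power of `ℂ⁴`. -/
def catVec (n : ℕ) (p q : Fin 4) : EuclideanSpace ℂ (Fin n → Fin 4) :=
  ((1 / Real.sqrt 2 : ℝ) : ℂ) • (EuclideanSpace.single (fun _ => p) (1 : ℂ)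
    + Complex.I • EuclideanSpace.single (fun _ => q) (1 : ℂ))

/-- The code for the binary tuple `x`: the span of the images of `|φ⟩` and `|ψ⟩` under
`U_{x₁} ⊗ … ⊗ U_{xₙ}`. -/
def code {n : ℕ} (x : Fin n → Fin 2) : Submodule ℂ (EuclideanSpace ℂ (Fin n → Fin 4)) :=
  Submodule.span ℂ
    {(tensorMatrix fun k => U (x k)).toEuclideanLin (catVec n 0 1),
     (tensorMatrix fun k => U (x k)).toEuclideanLin (catVec n 2 3)}

end QZero

end

/-!
The proof replaces statements about channels by statements about Kraus operators. A Stinespring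
isometry of `Φ` gives Kraus operators `A e`, and the noncommutative graph is the span of the
products `(A e)ᴴ * A e'`; for tensor products of channels it is spanned by the tensor products of
elements of the graphs (`SpansGraph.tensorChannel`). By the Knill–Laflamme theorem, two
orthonormal vectors `φ`, `ψ` span a code if and only if `⟨φ, M ψ⟩ = ⟨ψ, M φ⟩ = 0` and
`⟨φ, M φ⟩ = ⟨ψ, M ψ⟩` for all `M` in a spanning set of the graph. Necessity
(`IsErrorCorrectingCode.dotProduct_eq`) uses Kraus operators `R s` of the recovery channel, given
by Choi's theorem: every `R s * A e` is scalar on the code. Sufficiency (`exists_recovery`)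
diagonalizes the Gram matrix of the operators `A e` on the code.

If the angles add up to `π` modulo `2π`, the conditions for the explicit vectors are a computation
with the entries of `M`: the only term that does not cancel identically is proportional to
`cos ((θ₁ + … + θₙ) / 2)` (`tensor_graphL_conditions`). Conjugation by `W₄` fixes `𝔏_θ`, so all
the images are codes too, and `1, W₄ ∈ 𝔏_θ` gives their orthogonality.

For a single channel, `𝔏_θ` is block diagonal with two `2 × 2` blocks in which its elements are
combinations of Pauli matrices. A two-dimensional code has two components that are scaled
unitaries, and comparing the compressions of the traceless elements forces `cos (θ / 2) = 0`
(`eq_zero_of_compressions`). A three-dimensional code would meet both eigenspaces of an involution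
in `𝔏_θ` whose compression should be scalar (`finrank_code_le_two`).

For small angles, `𝔏_θ₁ ⊗ … ⊗ 𝔏_θₙ` is a deformation of the algebra `𝔏_0 ⊗ … ⊗ 𝔏_0`, which is
maximal commutative and is diagonalized by the Fourier transform on `(ℤ/2)^(2n)`. The deformation
is an entrywise multiplication that differs from the identity by at most
`δ = ∏ (1 + |γ_k - 1|) - 1` in norm (`norm_deform_sub_le`), and `δ < 1/2` under the hypothesis. If
`φ`, `ψ` satisfied the conditions, then the overlap `∑ |φ̂||ψ̂|` would be at most `δ` and the
distance `∑ ||φ̂|² - |ψ̂|²|` at most `2δ`; but the overlap plus half of the distance is at least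
`1` (`one_le_of_conditions`).
-/

namespace QZero

/-! ### Kraus representations -/

section Kraus

variable {α β ε κ : Type*} [Fintype α] [Fintype β] [Fintype ε] [Fintype κ]

/-- `A` is a family of Kraus operators of a trace preserving map `Φ`. -/
def IsKraus [DecidableEq α] (Φ : Matrix α α ℂ →ₗ[ℂ] Matrix β β ℂ) (A : ε → Matrix β α ℂ) :
    Prop :=
  (∀ ρ, Φ ρ = ∑ e, A e * ρ * (A e)ᴴ) ∧ ∑ e, (A e)ᴴ * A e = 1

theorem IsKraus.isChannel [DecidableEq α] {Φ : Matrix α α ℂ →ₗ[ℂ] Matrix β β ℂ}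
    {A : ε → Matrix β α ℂ} (h : IsKraus Φ A) : IsChannel Φ := by
  refine ⟨fun k X hX => ?_, fun X => ?_⟩
  · have key : amplify (Fin k) Φ X =
        ∑ e, ((1 : Matrix (Fin k) (Fin k) ℂ) ⊗ₖ A e) * X *
          ((1 : Matrix (Fin k) (Fin k) ℂ) ⊗ₖ A e)ᴴ := by
      ext ⟨i, b⟩ ⟨j, b'⟩
      simp only [amplify, h.1, Matrix.of_apply, Matrix.sum_apply]
      refine Finset.sum_congr rfl fun e _ => ?_
      simp [Matrix.mul_apply, Fintype.sum_prod_type, Matrix.kroneckerMap_apply,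
        Matrix.one_apply, Matrix.conjTranspose_apply, apply_ite (starRingEnd ℂ)]
    rw [key]
    exact Matrix.posSemidef_sum _ fun e _ => hX.mul_mul_conjTranspose_same _
  · rw [h.1, Matrix.trace_sum]
    have : ∀ e, (A e * X * (A e)ᴴ).trace = ((A e)ᴴ * A e * X).trace := fun e => by
      rw [Matrix.trace_mul_comm, Matrix.mul_assoc]
    simp only [this, ← Matrix.trace_sum, ← Finset.sum_mul, h.2, Matrix.one_mul]

/-- Choi's theorem: the block matrix of the images of the matrix units is positive, and a
factorization of it yields Kraus operators. -/
theorem IsChannel.exists_isKraus [DecidableEq α] {Φ : Matrix α α ℂ →ₗ[ℂ] Matrix β β ℂ}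
    (h : IsChannel Φ) : ∃ A : α × β → Matrix β α ℂ, IsKraus Φ A := by
  classical
  let k := Fintype.card α
  let f : Fin k ≃ α := (Fintype.equivFin α).symm
  let w : Fin k × α → ℂ := fun p => if f p.1 = p.2 then 1 else 0
  have hX : (Matrix.vecMulVec w (star w)).PosSemidef := Matrix.posSemidef_vecMulVec_self_star w
  have hC := (h.1 k _ hX).submatrix (fun p : α × β => (f.symm p.1, p.2))
  open scoped MatrixOrder Matrix.Norms.L2Operator in
  obtain ⟨N, hN⟩ := CStarAlgebra.nonneg_iff_eq_star_mul_self.1 (Matrix.nonneg_iff_posSemidef.2 hC)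
  have hent : ∀ i j b b', Φ (Matrix.single i j 1) b b' =
      ∑ s, star (N s (i, b)) * N s (j, b') := by
    intro i j b b'
    have := congrFun (congrFun hN (i, b)) (j, b')
    simp only [Matrix.mul_apply, Matrix.star_apply, Matrix.submatrix_apply, amplify,
      Matrix.of_apply] at this
    rw [← this]
    refine congrArg (fun M => Φ M b b') ?_
    ext a a'
    simp [Matrix.vecMulVec_apply, w, Matrix.single_apply, ← ite_and, and_comm]
  have hΦ : ∀ ρ, Φ ρ = ∑ s, (Matrix.of fun b i => star (N s (i, b))) * ρ *
      (Matrix.of fun b i => star (N s (i, b)))ᴴ := by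
    intro ρ
    ext b b'
    conv_lhs => rw [Matrix.matrix_eq_sum_single ρ]
    have : ∀ i j, Matrix.single i j (ρ i j) = ρ i j • Matrix.single i j (1 : ℂ) := by
      intro i j; simp [Matrix.smul_single]
    simp only [this, map_sum, map_smul, Matrix.sum_apply, Matrix.smul_apply, hent, smul_eq_mul,
      Matrix.mul_apply, Matrix.conjTranspose_apply, Matrix.of_apply, star_star, Finset.sum_mul,
      Finset.mul_sum]
    rw [Finset.sum_comm]
    rw [Finset.sum_congr rfl fun j _ => Finset.sum_comm, Finset.sum_comm]
    exact Finset.sum_congr rfl fun s _ => Finset.sum_congr rfl fun j _ =>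
      Finset.sum_congr rfl fun i _ => by ring
  refine ⟨_, hΦ, ?_⟩
  -- the trace condition on the matrix units determines the sum of the `A e ᴴ * A e`
  ext i j
  have h1 := h.2 (Matrix.single j i 1)
  have h2 : (Matrix.single j i (1 : ℂ)).trace = (1 : Matrix α α ℂ) i j := by
    by_cases hij : i = j
    · subst hij; simp
    · rw [Matrix.trace_single_eq_of_ne _ _ _ (Ne.symm hij), Matrix.one_apply_ne hij]
  rw [← h2, ← h1]
  simp only [Matrix.trace, Matrix.diag, hent, Matrix.sum_apply, Matrix.mul_apply,
    Matrix.conjTranspose_apply, Matrix.of_apply, star_star]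
  rw [Finset.sum_comm]
  exact Finset.sum_congr rfl fun s _ => Finset.sum_congr rfl fun j _ => by ring

/-- The Kraus operators read off from a Stinespring isometry. -/
def krausOf {m : ℕ} (V : Matrix (β × Fin m) α ℂ) (e : Fin m) : Matrix β α ℂ :=
  Matrix.of fun b a => V (b, e) a

theorem IsStinespring.isKraus [DecidableEq α] {m : ℕ} {Φ : Matrix α α ℂ →ₗ[ℂ] Matrix β β ℂ}
    {V : Matrix (β × Fin m) α ℂ} (h : IsStinespring Φ V) : IsKraus Φ (krausOf V) := by
  refine ⟨fun ρ => ?_, ?_⟩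
  · rw [h.2]
    ext b b'
    simp [traceRight, krausOf, Matrix.mul_apply, Matrix.sum_apply]
  · rw [← h.1]
    ext i j
    simp only [krausOf, Matrix.mul_apply, Matrix.sum_apply, Matrix.conjTranspose_apply,
      Matrix.of_apply, Fintype.sum_prod_type]
    exact Finset.sum_comm

theorem dualMap_complementary [DecidableEq α] {m : ℕ} (V : Matrix (β × Fin m) α ℂ)
    (X : Matrix (Fin m) (Fin m) ℂ) :
    dualMap (complementary V) X =
      ∑ e, ∑ e', X e e' • ((krausOf V e)ᴴ * krausOf V e') := by
  ext i j
  have h : ∀ e e', complementary V (Matrix.single j i 1) e e' =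
      ∑ b, V (b, e) j * star (V (b, e') i) := by
    intro e e'
    simp [complementary, traceLeft, Matrix.mul_apply, Matrix.single_apply, ite_and]
  simp only [dualMap, Matrix.of_apply, Matrix.trace, Matrix.diag, Matrix.mul_apply, h,
    Matrix.sum_apply, Matrix.smul_apply, krausOf, Matrix.conjTranspose_apply, smul_eq_mul,
    Finset.sum_mul, Finset.mul_sum]
  rw [Finset.sum_comm]
  exact Finset.sum_congr rfl fun s _ => Finset.sum_congr rfl fun j _ =>
    Finset.sum_congr rfl fun i _ => by ring

/-- A noncommutative graph is spanned by the products `A eᴴ * A e'` of Kraus operators. -/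
theorem IsNoncommutativeGraph.exists_isKraus [DecidableEq α]
    {Φ : Matrix α α ℂ →ₗ[ℂ] Matrix β β ℂ} {L : Set (Matrix α α ℂ)}
    (h : IsNoncommutativeGraph Φ L) :
    ∃ (m : ℕ) (A : Fin m → Matrix β α ℂ), IsKraus Φ A ∧ (∀ e e', (A e)ᴴ * A e' ∈ L) ∧
      ∀ M ∈ L, ∃ X : Fin m → Fin m → ℂ, M = ∑ e, ∑ e', X e e' • ((A e)ᴴ * A e') := by
  obtain ⟨m, V, hV, rfl⟩ := h
  refine ⟨m, krausOf V, hV.isKraus, fun e e' => ⟨Matrix.single e e' 1, ?_⟩, ?_⟩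
  · rw [dualMap_complementary]
    simp [Matrix.single_apply, ite_and]
  · rintro _ ⟨X, rfl⟩
    exact ⟨X, dualMap_complementary V X⟩

end Kraus

/-! ### The Knill–Laflamme conditions -/

section KnillLaflamme

variable {α β ε κ : Type*} [Fintype α] [Fintype β] [Fintype ε] [Fintype κ]

theorem sum_normSq_eq_zero {ι : Type*} [Fintype ι] {f : ι → ℂ} (h : ∑ i, f i * star (f i) = 0)
    (i : ι) : f i = 0 := by
  have h' : ∑ i, Complex.normSq (f i) = 0 := by
    have : ((∑ i, Complex.normSq (f i) : ℝ) : ℂ) = 0 := by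
      rw [← h]; push_cast
      exact Finset.sum_congr rfl fun i _ => (Complex.mul_conj _).symm
    exact_mod_cast this
  exact Complex.normSq_eq_zero.1
    ((Finset.sum_eq_zero_iff_of_nonneg fun i _ => Complex.normSq_nonneg _).1 h' i
      (Finset.mem_univ i))

/-- If a sum of operators `B v (B v)ᴴ` is the rank one operator `v vᴴ`, then `v` is an eigenvector
of every `B`: no component orthogonal to `v` may occur. -/
theorem exists_mulVec_eq_smul {B : ε → Matrix α α ℂ} {v : α → ℂ}
    (h : ∑ e, B e * Matrix.vecMulVec v (star v) * (B e)ᴴ = Matrix.vecMulVec v (star v))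
    (hv : star v ⬝ᵥ v = 1) (e : ε) : B e *ᵥ v = (star v ⬝ᵥ (B e *ᵥ v)) • v := by
  set u : ε → α → ℂ := fun e => B e *ᵥ v
  have h1 : ∑ e, Matrix.vecMulVec (u e) (star (u e)) = Matrix.vecMulVec v (star v) := by
    rw [← h]
    refine Finset.sum_congr rfl fun e _ => ?_
    rw [Matrix.mul_vecMulVec, Matrix.vecMulVec_mul, Matrix.star_mulVec]
  have ent : ∀ i j, ∑ e, u e i * star (u e j) = v i * star (v j) := by
    intro i j
    have := congrFun (congrFun h1 i) j
    simpa [Matrix.sum_apply, Matrix.vecMulVec_apply] using this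
  -- the component of `u e` orthogonal to `v`
  set c : ε → ℂ := fun e => star v ⬝ᵥ u e
  have hc1 : ∀ i, ∑ e, u e i * star (c e) = v i := by
    intro i
    have : ∀ e, u e i * star (c e) = ∑ j, v j * (u e i * star (u e j)) := by
      intro e
      simp only [c, dotProduct, star_sum, Finset.mul_sum, star_mul', Pi.star_apply, star_star]
      exact Finset.sum_congr rfl fun j _ => by ring
    simp only [this]
    rw [Finset.sum_comm]
    simp only [← Finset.mul_sum, ent]
    have hv' : ∑ j, star (v j) * v j = 1 := hv
    calc ∑ j, v j * (v i * star (v j)) = v i * ∑ j, star (v j) * v j := by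
          rw [Finset.mul_sum]; exact Finset.sum_congr rfl fun j _ => by ring
      _ = v i := by rw [hv', mul_one]
  have hc2 : ∑ e, c e * star (c e) = 1 := by
    have : ∀ e, c e * star (c e) = ∑ i, star (v i) * (u e i * star (c e)) := by
      intro e
      conv_lhs => rw [show c e = ∑ i, star (v i) * u e i from rfl, Finset.sum_mul]
      exact Finset.sum_congr rfl fun j _ => by ring_nf; rfl
    simp only [this]
    rw [Finset.sum_comm]
    simp only [← Finset.mul_sum, hc1]
    exact hv
  ext i
  have hz : ∑ e, (u e i - c e * v i) * star (u e i - c e * v i) = 0 := by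
    have hc1' : ∑ e, c e * star (u e i) = star (v i) := by
      rw [← hc1 i, star_sum]
      exact Finset.sum_congr rfl fun j _ => by simp [mul_comm]
    have : ∀ e, (u e i - c e * v i) * star (u e i - c e * v i) =
        u e i * star (u e i) - star (v i) * (u e i * star (c e)) - v i * (c e * star (u e i))
          + v i * star (v i) * (c e * star (c e)) := by
      intro e; simp only [star_sub, star_mul']; ring
    simp only [this, Finset.sum_add_distrib, Finset.sum_sub_distrib, ← Finset.mul_sum, hc1, hc1',
      hc2, ent]
    ring
  have := sum_normSq_eq_zero hz e
  simpa [sub_eq_zero] using this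

theorem supportedBy_vecMulVec [DecidableEq α] {K : Submodule ℂ (EuclideanSpace ℂ α)}
    {v : α → ℂ} (hv : WithLp.toLp 2 v ∈ K) :
    SupportedBy (Matrix.vecMulVec v (star v)) K := by
  rintro _ ⟨w, rfl⟩
  have : (Matrix.vecMulVec v (star v)).toEuclideanLin w =
      (star v ⬝ᵥ w.ofLp) • WithLp.toLp 2 v := by
    ext i
    simp [Matrix.vecMulVec_mulVec]
    ring
  rw [this]
  exact K.smul_mem _ hv

/-- Necessity of the Knill–Laflamme conditions, for a pair of orthonormal code vectors. -/
theorem IsErrorCorrectingCode.dotProduct_eq [DecidableEq α]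
    {Φ : Matrix α α ℂ →ₗ[ℂ] Matrix β β ℂ} {A : ε → Matrix β α ℂ} (hA : IsKraus Φ A)
    {K : Submodule ℂ (EuclideanSpace ℂ α)} (hK : IsErrorCorrectingCode Φ K) {φ ψ : α → ℂ}
    (hφK : WithLp.toLp 2 φ ∈ K) (hψK : WithLp.toLp 2 ψ ∈ K)
    (hφ : star φ ⬝ᵥ φ = 1) (hψ : star ψ ⬝ᵥ ψ = 1) (hφψ : star φ ⬝ᵥ ψ = 0) (e e' : ε) :
    star φ ⬝ᵥ (((A e)ᴴ * A e') *ᵥ ψ) = 0 ∧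
      star φ ⬝ᵥ (((A e)ᴴ * A e') *ᵥ φ) = star ψ ⬝ᵥ (((A e)ᴴ * A e') *ᵥ ψ) := by
  classical
  obtain ⟨Θ, hΘ, hrec⟩ := hK
  obtain ⟨R, hR⟩ := hΘ.exists_isKraus
  have hψφ : star ψ ⬝ᵥ φ = 0 := by rw [Matrix.star_dotProduct, hφψ, star_zero]
  have eig : ∀ v : α → ℂ, WithLp.toLp 2 v ∈ K → star v ⬝ᵥ v = 1 → ∀ s f,
      (R s * A f) *ᵥ v = (star v ⬝ᵥ ((R s * A f) *ᵥ v)) • v := by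
    intro v hv hv1 s f
    have h1 := hrec (Matrix.vecMulVec v (star v)) ⟨Matrix.posSemidef_vecMulVec_self_star v, by
      rw [Matrix.trace_vecMulVec, dotProduct_comm, hv1]⟩ (supportedBy_vecMulVec hv)
    refine exists_mulVec_eq_smul (B := fun p : (β × α) × ε => R p.1 * A p.2) ?_ hv1 (s, f)
    rw [hR.1, hA.1] at h1
    conv_rhs => rw [← h1]
    rw [Fintype.sum_prod_type]
    refine Finset.sum_congr rfl fun s _ => ?_
    rw [Matrix.mul_sum, Matrix.sum_mul]
    refine Finset.sum_congr rfl fun f _ => ?_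
    simp only [Matrix.conjTranspose_mul, Matrix.mul_assoc]
  set c : β × α → ε → ℂ := fun s f => star φ ⬝ᵥ ((R s * A f) *ᵥ φ) with hc
  have hφe : ∀ s f, (R s * A f) *ᵥ φ = c s f • φ := eig φ hφK hφ
  -- `φ + ψ` is an eigenvector as well, so the eigenvalues at `φ` and `ψ` agree
  have hψe : ∀ s f, (R s * A f) *ᵥ ψ = c s f • ψ := by
    intro s f
    have h2 := eig ψ hψK hψ s f
    set d := star ψ ⬝ᵥ ((R s * A f) *ᵥ ψ)
    obtain ⟨r, hr⟩ : ∃ r : ℂ, star r * r * 2 = 1 := by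
      refine ⟨((√2 : ℝ) : ℂ)⁻¹, ?_⟩
      have : ((√2 : ℝ) : ℂ) * ((√2 : ℝ) : ℂ) = 2 := by
        rw [← Complex.ofReal_mul]; norm_num
      simp only [star_inv₀, Complex.star_def, Complex.conj_ofReal]
      rw [← mul_inv, this]; norm_num
    have hr0 : r ≠ 0 := by rintro rfl; simp at hr
    have h3 := eig (r • (φ + ψ))
      (by simpa using K.smul_mem r (K.add_mem hφK hψK)) (by
        simp only [star_smul, star_add, smul_dotProduct, dotProduct_smul, add_dotProduct,
          dotProduct_add, hφ, hψ, hφψ, hψφ, smul_eq_mul]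
        linear_combination hr) s f
    set k := star (r • (φ + ψ)) ⬝ᵥ ((R s * A f) *ᵥ (r • (φ + ψ)))
    rw [Matrix.mulVec_smul, Matrix.mulVec_add, h2, hφe, smul_comm k r] at h3
    have h4 : c s f • φ + d • ψ = k • (φ + ψ) := smul_right_injective _ hr0 h3
    have e1 := congrArg (star φ ⬝ᵥ ·) h4
    have e2 := congrArg (star ψ ⬝ᵥ ·) h4
    simp only [dotProduct_add, dotProduct_smul, hφ, hψ, hφψ, hψφ, smul_eq_mul, mul_one, mul_zero,
      add_zero, zero_add] at e1 e2
    rw [h2, e1, e2]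
  have split : ∀ u v : α → ℂ, (∀ s f, (R s * A f) *ᵥ u = c s f • u) →
      (∀ s f, (R s * A f) *ᵥ v = c s f • v) →
      star u ⬝ᵥ (((A e)ᴴ * A e') *ᵥ v) = (∑ s, star (c s e) * c s e') * (star u ⬝ᵥ v) := by
    intro u v hu hv
    have h1 : (A e)ᴴ * A e' = ∑ s, (R s * A e)ᴴ * (R s * A e') := by
      have : ∀ s, (R s * A e)ᴴ * (R s * A e') = (A e)ᴴ * ((R s)ᴴ * R s) * A e' := by
        intro s; simp only [Matrix.conjTranspose_mul, Matrix.mul_assoc]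
      simp only [this, ← Matrix.sum_mul, ← Matrix.mul_sum, hR.2, Matrix.mul_one]
    rw [h1, Matrix.sum_mulVec, dotProduct_sum, Finset.sum_mul]
    refine Finset.sum_congr rfl fun s _ => ?_
    rw [← Matrix.mulVec_mulVec, hv, Matrix.dotProduct_mulVec, ← Matrix.star_mulVec, hu]
    simp only [star_smul, smul_dotProduct, dotProduct_smul, smul_eq_mul]
    ring
  refine ⟨?_, ?_⟩
  · rw [split φ ψ hφe hψe, hφψ, mul_zero]
  · rw [split φ φ hφe hφe, split ψ ψ hψe hψe, hφ, hψ]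

/-- The map with prescribed Kraus operators. -/
noncomputable def krausMap (A : ε → Matrix β α ℂ) : Matrix α α ℂ →ₗ[ℂ] Matrix β β ℂ where
  toFun ρ := ∑ e, A e * ρ * (A e)ᴴ
  map_add' ρ σ := by simp [Matrix.mul_add, Matrix.add_mul, Finset.sum_add_distrib]
  map_smul' c ρ := by simp [Finset.smul_sum]

/-- The recovery channel for a family `F` with `(F f)ᴴ * F f' = δ_{f f'} d f`. The operators
`(d f)^(-1/2) • J * (F f)ᴴ` undo `F`; indices with `d f = 0` contribute nothing because `0⁻¹ = 0`.
On the orthogonal complement of the ranges of all `F f` the channel outputs a fixed state. -/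
theorem exists_recovery_of_orthogonal [DecidableEq κ] [Nonempty α] [DecidableEq ε]
    (F : ε → Matrix β κ ℂ) (J : Matrix α κ ℂ) (hJ : Jᴴ * J = 1) (d : ε → ℝ) (hd : ∀ f, 0 ≤ d f)
    (hF : ∀ f f', (F f)ᴴ * F f' = if f = f' then (d f : ℂ) • (1 : Matrix κ κ ℂ) else 0)
    (hsum : ∑ f, d f = 1) :
    ∃ Θ : Matrix β β ℂ →ₗ[ℂ] Matrix α α ℂ, IsChannel Θ ∧
      ∀ X : Matrix κ κ ℂ, Θ (∑ f, F f * X * (F f)ᴴ) = J * X * Jᴴ := by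
  classical
  obtain ⟨a₀⟩ := ‹Nonempty α›
  have hF0 : ∀ f, d f = 0 → F f = 0 := by
    intro f hf
    have := hF f f
    rw [if_pos rfl, hf, Complex.ofReal_zero, zero_smul] at this
    exact Matrix.conjTranspose_mul_self_eq_zero.1 this
  have hinv : ∀ f, ((d f : ℂ)⁻¹ * d f) • F f = F f := by
    intro f
    by_cases hf : d f = 0
    · rw [hF0 f hf, smul_zero]
    · rw [inv_mul_cancel₀ (by exact_mod_cast hf), one_smul]
  set p : Matrix β β ℂ := ∑ f, (d f : ℂ)⁻¹ • (F f * (F f)ᴴ) with hp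
  have hpF : ∀ f, p * F f = F f := by
    intro f
    simp only [hp, Matrix.sum_mul, Matrix.smul_mul, Matrix.mul_assoc, hF]
    rw [Finset.sum_eq_single f (fun g _ hg => by rw [if_neg hg, Matrix.mul_zero, smul_zero])
      (fun h => absurd (Finset.mem_univ f) h), if_pos rfl, Matrix.mul_smul, Matrix.mul_one,
      smul_smul, hinv]
  have hpp : p * p = p := by
    conv_lhs => rw [hp, Matrix.mul_sum]
    rw [hp]
    refine Finset.sum_congr rfl fun f _ => ?_
    rw [Matrix.mul_smul, ← Matrix.mul_assoc, ← hp, hpF]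
  have hph : pᴴ = p := by
    simp [hp, Matrix.conjTranspose_sum, Matrix.conjTranspose_smul]
  set q : Matrix β β ℂ := 1 - p with hq
  have hqF : ∀ f, q * F f = 0 := by
    intro f; rw [hq, Matrix.sub_mul, Matrix.one_mul, hpF, sub_self]
  have hqh : qᴴ = q := by rw [hq, Matrix.conjTranspose_sub, hph, Matrix.conjTranspose_one]
  have hqq : q * q = q := by
    simp only [hq, Matrix.sub_mul, Matrix.mul_sub, hpp, Matrix.one_mul, Matrix.mul_one]
    abel
  set r : ε → ℂ := fun f => ((Real.sqrt (d f)⁻¹ : ℝ) : ℂ) with hr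
  have hrr : ∀ f, r f * star (r f) = (d f : ℂ)⁻¹ := by
    intro f
    simp only [hr, Complex.star_def, Complex.conj_ofReal, ← Complex.ofReal_mul,
      Real.mul_self_sqrt (inv_nonneg.2 (hd f)), Complex.ofReal_inv]
  set R : ε ⊕ β → Matrix α β ℂ :=
    Sum.elim (fun f => r f • (J * (F f)ᴴ)) (fun b => Matrix.single a₀ b (1 : ℂ) * q) with hR
  have hRsum : ∑ e, (R e)ᴴ * R e = 1 := by
    rw [Fintype.sum_sum_type]
    have h1 : ∑ f, (R (Sum.inl f))ᴴ * R (Sum.inl f) = p := by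
      rw [hp]
      refine Finset.sum_congr rfl fun f _ => ?_
      simp only [hR, Sum.elim_inl, Matrix.conjTranspose_smul, Matrix.smul_mul, Matrix.mul_smul,
        smul_smul, hrr, Matrix.conjTranspose_mul, Matrix.conjTranspose_conjTranspose]
      rw [Matrix.mul_assoc, ← Matrix.mul_assoc Jᴴ, hJ, Matrix.one_mul]
    have h2 : ∑ b, (R (Sum.inr b))ᴴ * R (Sum.inr b) = q := by
      have : ∀ b, (R (Sum.inr b))ᴴ * R (Sum.inr b) = q * Matrix.single b b 1 * q := by
        intro b
        simp only [hR, Sum.elim_inr, Matrix.conjTranspose_mul, hqh,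
          Matrix.conjTranspose_single, star_one]
        rw [Matrix.mul_assoc, ← Matrix.mul_assoc (Matrix.single b a₀ 1),
          Matrix.single_mul_single_same, mul_one, Matrix.mul_assoc]
      simp only [this, ← Matrix.sum_mul, ← Matrix.mul_sum]
      have h1 : ∑ b : β, Matrix.single b b (1 : ℂ) = 1 := by
        ext i j
        simp [Matrix.sum_apply, Matrix.single_apply, Matrix.one_apply, ite_and]
      rw [h1, Matrix.mul_one, hqq]
    rw [h1, h2, hq]; abel
  have hK : IsKraus (krausMap R) R := ⟨fun ρ => rfl, hRsum⟩
  refine ⟨krausMap R, hK.isChannel, fun X => ?_⟩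
  have e1 : ∀ f f', R (Sum.inl f) * F f' = if f = f' then (r f * d f) • J else 0 := by
    intro f f'
    simp only [hR, Sum.elim_inl, Matrix.smul_mul, Matrix.mul_assoc, hF]
    split_ifs <;> simp [mul_smul]
  have e2 : ∀ b f, R (Sum.inr b) * F f = 0 := by
    intro b f
    simp only [hR, Sum.elim_inr, Matrix.mul_assoc, hqF, Matrix.mul_zero]
  have e3 : ∀ e f, R e * (F f * X * (F f)ᴴ) * (R e)ᴴ = (R e * F f) * X * (R e * F f)ᴴ := by
    intro e f; simp only [Matrix.conjTranspose_mul, Matrix.mul_assoc]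
  change ∑ e, R e * (∑ f, F f * X * (F f)ᴴ) * (R e)ᴴ = _
  simp only [Matrix.mul_sum, Matrix.sum_mul, e3]
  rw [Fintype.sum_sum_type]
  have e4 : ∀ f f', R (Sum.inl f) * F f' * X * (R (Sum.inl f) * F f')ᴴ =
      if f = f' then (d f : ℂ) • (J * X * Jᴴ) else 0 := by
    intro f f'
    rw [e1]
    split_ifs with h
    · simp only [Matrix.conjTranspose_smul, Matrix.smul_mul, Matrix.mul_smul, smul_smul]
      congr 1
      have : star (r f * d f) * (r f * d f) = (r f * star (r f) * d f) * d f := by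
        simp only [star_mul', Complex.star_def, Complex.conj_ofReal]; ring
      rw [this, hrr]
      by_cases hf : d f = 0
      · simp [hf]
      · rw [inv_mul_cancel₀ (by exact_mod_cast hf), one_mul]
    · simp
  simp only [e4, e2, Matrix.zero_mul, Finset.sum_const_zero, add_zero, Finset.sum_ite_eq,
    Finset.mem_univ, if_true, ← Finset.sum_smul]
  rw [← Complex.ofReal_sum, hsum, Complex.ofReal_one, one_smul]

/-- Sufficiency of the Knill–Laflamme conditions: diagonalizing the Gram matrix `Λ` replaces the
operators `A e * J` by an orthogonal family with the same associated map. -/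
theorem exists_recovery [DecidableEq α] [DecidableEq κ] [Nonempty κ] {A : ε → Matrix β α ℂ}
    (hA : ∑ e, (A e)ᴴ * A e = 1) {J : Matrix α κ ℂ} (hJ : Jᴴ * J = 1) {Λ : Matrix ε ε ℂ}
    (hΛ : ∀ e e', Jᴴ * ((A e)ᴴ * A e') * J = Λ e e' • (1 : Matrix κ κ ℂ)) :
    ∃ Θ : Matrix β β ℂ →ₗ[ℂ] Matrix α α ℂ, IsChannel Θ ∧
      ∀ X : Matrix κ κ ℂ, Θ (∑ e, A e * (J * X * Jᴴ) * (A e)ᴴ) = J * X * Jᴴ := by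
  classical
  obtain ⟨k⟩ := ‹Nonempty κ›
  have : Nonempty α := by
    by_contra h
    rw [not_nonempty_iff] at h
    have := congrFun (congrFun hJ k) k
    simp [Matrix.mul_apply] at this
  have hherm : Λ.IsHermitian := by
    ext e e'
    have h1 := congrArg Matrix.conjTranspose (hΛ e' e)
    have h2 := hΛ e e'
    simp only [Matrix.conjTranspose_mul, Matrix.conjTranspose_conjTranspose,
      Matrix.conjTranspose_smul, Matrix.conjTranspose_one, Matrix.mul_assoc] at h1 h2
    have := congrFun (congrFun (h1.symm.trans h2) k) k
    simpa using this
  set W : Matrix ε ε ℂ := (hherm.eigenvectorUnitary : Matrix ε ε ℂ) with hW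
  set d := hherm.eigenvalues
  have hWW : Wᴴ * W = 1 := Unitary.coe_star_mul_self hherm.eigenvectorUnitary
  have hWW' : W * Wᴴ = 1 := Unitary.coe_mul_star_self hherm.eigenvectorUnitary
  have hdiag : Wᴴ * Λ * W = Matrix.diagonal fun f => (d f : ℂ) := by
    have h := hherm.spectral_theorem
    rw [Unitary.conjStarAlgAut_apply] at h
    rw [h]
    change Wᴴ * (W * _ * Wᴴ) * W = _
    rw [Matrix.mul_assoc, Matrix.mul_assoc _ Wᴴ, hWW, Matrix.mul_one, ← Matrix.mul_assoc, hWW,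
      Matrix.one_mul]
    rfl
  set F : ε → Matrix β κ ℂ := fun f => ∑ e, W e f • (A e * J) with hFdef
  have hF : ∀ f f', (F f)ᴴ * F f' = if f = f' then (d f : ℂ) • (1 : Matrix κ κ ℂ) else 0 := by
    intro f f'
    have h1 : (F f)ᴴ * F f' = (Wᴴ * Λ * W) f f' • (1 : Matrix κ κ ℂ) := by
      simp only [hFdef, Matrix.conjTranspose_sum, Matrix.conjTranspose_smul, Matrix.sum_mul,
        Matrix.mul_sum, Matrix.smul_mul, Matrix.mul_smul, Matrix.conjTranspose_mul]
      have : ∀ e e', Jᴴ * (A e)ᴴ * (A e' * J) = Λ e e' • (1 : Matrix κ κ ℂ) := by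
        intro e e'; rw [← hΛ]; simp only [Matrix.mul_assoc]
      simp only [this, Matrix.mul_apply, Finset.sum_mul, Finset.sum_smul, smul_smul,
        Finset.smul_sum, Matrix.conjTranspose_apply]
      exact Finset.sum_congr rfl fun e _ => Finset.sum_congr rfl fun e' _ => by
        congr 1; ring
    rw [h1, hdiag, Matrix.diagonal_apply]
    split_ifs <;> simp
  have hd : ∀ f, 0 ≤ d f := by
    intro f
    have h1 := (Matrix.posSemidef_conjTranspose_mul_self (F f)).diag_nonneg (i := k)
    rw [hF, if_pos rfl] at h1
    simpa using h1
  have hsum : ∑ f, d f = 1 := by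
    have h1 : Λ.trace = 1 := by
      have h2 : ∑ e, Jᴴ * ((A e)ᴴ * A e) * J = (1 : Matrix κ κ ℂ) := by
        rw [← Matrix.sum_mul, ← Matrix.mul_sum, hA, Matrix.mul_one, hJ]
      simp only [hΛ, ← Finset.sum_smul] at h2
      have := congrFun (congrFun h2 k) k
      simpa [Matrix.trace] using this
    have h3 := hherm.trace_eq_sum_eigenvalues
    rw [h1] at h3
    have h4 : ((∑ f, d f : ℝ) : ℂ) = 1 := by rw [h3]; push_cast; rfl
    exact_mod_cast h4
  obtain ⟨Θ, hΘ, hrec⟩ := exists_recovery_of_orthogonal F J hJ d hd hF hsum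
  refine ⟨Θ, hΘ, fun X => ?_⟩
  refine Eq.trans (congrArg Θ (Eq.symm ?_)) (hrec X)
  have h1 : ∀ f, F f * X * (F f)ᴴ =
      ∑ e, ∑ e', (W e f * star (W e' f)) • (A e * (J * X * Jᴴ) * (A e')ᴴ) := by
    intro f
    simp only [hFdef, Matrix.conjTranspose_sum, Matrix.conjTranspose_smul, Matrix.sum_mul,
        Matrix.mul_sum, Matrix.smul_mul, Matrix.mul_smul, Matrix.conjTranspose_mul, smul_smul,
        Finset.smul_sum, Matrix.mul_assoc]
    rw [Finset.sum_comm]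
    exact Finset.sum_congr rfl fun e _ => Finset.sum_congr rfl fun e' _ => by
        congr 1; ring
  have h2 : ∀ e e', ∑ f, W e f * star (W e' f) = (1 : Matrix ε ε ℂ) e e' := by
    intro e e'
    have := congrFun (congrFun hWW' e) e'
    simpa [Matrix.mul_apply] using this
  simp only [h1]
  rw [Finset.sum_comm]
  refine Finset.sum_congr rfl fun e _ => ?_
  rw [Finset.sum_comm]
  have h3 : ∀ e', ∑ f, (W e f * star (W e' f)) • (A e * (J * X * Jᴴ) * (A e')ᴴ) =
      (1 : Matrix ε ε ℂ) e e' • (A e * (J * X * Jᴴ) * (A e')ᴴ) := fun e' => by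
    rw [← h2, Finset.sum_smul]
  rw [Finset.sum_congr rfl fun e' _ => h3 e']
  rw [Finset.sum_eq_single e (fun e' _ he => by rw [Matrix.one_apply_ne' he, zero_smul])
    (fun h => absurd (Finset.mem_univ e) h), Matrix.one_apply_eq, one_smul]

/-- Sufficiency of the Knill–Laflamme conditions, for the span of two orthonormal vectors. -/
theorem isErrorCorrectingCode_span_pair [DecidableEq α]
    {Φ : Matrix α α ℂ →ₗ[ℂ] Matrix β β ℂ} {A : ε → Matrix β α ℂ} (hA : IsKraus Φ A)
    {φ ψ : EuclideanSpace ℂ α} (hφ : star φ.ofLp ⬝ᵥ φ.ofLp = 1) (hψ : star ψ.ofLp ⬝ᵥ ψ.ofLp = 1)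
    (hφψ : star φ.ofLp ⬝ᵥ ψ.ofLp = 0)
    (h : ∀ e e', star φ.ofLp ⬝ᵥ (((A e)ᴴ * A e') *ᵥ ψ.ofLp) = 0 ∧
      star ψ.ofLp ⬝ᵥ (((A e)ᴴ * A e') *ᵥ φ.ofLp) = 0 ∧
      star φ.ofLp ⬝ᵥ (((A e)ᴴ * A e') *ᵥ φ.ofLp) =
        star ψ.ofLp ⬝ᵥ (((A e)ᴴ * A e') *ᵥ ψ.ofLp)) :
    IsErrorCorrectingCode Φ (Submodule.span ℂ {φ, ψ}) := by
  set v : Fin 2 → α → ℂ := ![φ.ofLp, ψ.ofLp] with hv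
  set J : Matrix α (Fin 2) ℂ := Matrix.of fun a i => v i a with hJdef
  have hent : ∀ (M : Matrix α α ℂ) i j, (Jᴴ * M * J) i j = star (v i) ⬝ᵥ (M *ᵥ v j) := by
    intro M i j
    rw [Matrix.mul_assoc]
    simp only [Matrix.mul_apply, dotProduct, Matrix.mulVec, hJdef, Matrix.conjTranspose_apply,
      Matrix.of_apply, Pi.star_apply]
  have hψφ : star ψ.ofLp ⬝ᵥ φ.ofLp = 0 := by rw [Matrix.star_dotProduct, hφψ, star_zero]
  have hJ : Jᴴ * J = 1 := by
    rw [← Matrix.mul_one Jᴴ]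
    ext i j
    rw [hent, Matrix.one_mulVec]
    fin_cases i <;> fin_cases j <;> simp [hv, hφ, hψ, hφψ, hψφ]
  have hΛ : ∀ e e', Jᴴ * ((A e)ᴴ * A e') * J =
      (Matrix.of fun e e' => star φ.ofLp ⬝ᵥ (((A e)ᴴ * A e') *ᵥ φ.ofLp)) e e' •
        (1 : Matrix (Fin 2) (Fin 2) ℂ) := by
    intro e e'
    obtain ⟨h1, h2, h3⟩ := h e e'
    ext i j
    rw [hent]
    fin_cases i <;> fin_cases j <;> simp [hv, h1, h2, h3]
  obtain ⟨Θ, hΘ, hrec⟩ := exists_recovery hA.2 hJ hΛ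
  refine ⟨Θ, hΘ, fun ρ hρ hsupp => ?_⟩
  -- an operator supported by the code is compressed to itself by the projection `J * Jᴴ`
  have hcol : ∀ w ∈ Submodule.span ℂ {φ, ψ}, (J * Jᴴ) *ᵥ w.ofLp = w.ofLp := by
    intro w hw
    obtain ⟨x, y, rfl⟩ := Submodule.mem_span_pair.1 hw
    have hw' : (x • φ + y • ψ).ofLp = J *ᵥ ![x, y] := by
      ext a
      simp [hJdef, hv, Matrix.mulVec, dotProduct, Fin.sum_univ_two, mul_comm]
    rw [hw', Matrix.mulVec_mulVec, Matrix.mul_assoc, hJ, Matrix.mul_one]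
  have h1 : J * Jᴴ * ρ = ρ := by
    ext i j
    have := congrFun (hcol _ (hsupp ⟨EuclideanSpace.single j 1, rfl⟩)) i
    simp only [Matrix.ofLp_toLpLin, Matrix.toLin'_apply, PiLp.ofLp_single,
      Matrix.mulVec_single_one] at this
    exact this
  have h2 : ρ * (J * Jᴴ) = ρ := by
    have := congrArg Matrix.conjTranspose h1
    rwa [Matrix.conjTranspose_mul, hρ.1.1.eq, Matrix.conjTranspose_mul,
      Matrix.conjTranspose_conjTranspose] at this
  have h3 : ρ = J * (Jᴴ * ρ * J) * Jᴴ := by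
    conv_lhs => rw [← h2, ← h1]
    simp only [Matrix.mul_assoc]
  have := hrec (Jᴴ * ρ * J)
  rwa [← h3, ← hA.1] at this

end KnillLaflamme

/-! ### Noncommutative graphs of tensor products -/

section Tensor

/-- The set `S` has the same span as the operators `(A e)ᴴ * A e'` for some Kraus operators `A` of
`Φ`, that is, `S` spans the noncommutative graph of `Φ`. -/
def SpansGraph {α β : Type*} [Fintype α] [DecidableEq α] [Fintype β]
    (Φ : Matrix α α ℂ →ₗ[ℂ] Matrix β β ℂ) (S : Set (Matrix α α ℂ)) : Prop :=
  ∃ (ε : Type) (_ : Fintype ε) (A : ε → Matrix β α ℂ), IsKraus Φ A ∧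
    (∀ e e', (A e)ᴴ * A e' ∈ S) ∧
      ∀ M ∈ S, ∃ X : ε → ε → ℂ, M = ∑ e, ∑ e', X e e' • ((A e)ᴴ * A e')

theorem IsNoncommutativeGraph.spansGraph {α β : Type*} [Fintype α] [DecidableEq α] [Fintype β]
    {Φ : Matrix α α ℂ →ₗ[ℂ] Matrix β β ℂ} {L : Set (Matrix α α ℂ)}
    (h : IsNoncommutativeGraph Φ L) : SpansGraph Φ L := by
  obtain ⟨m, A, hA⟩ := h.exists_isKraus
  exact ⟨Fin m, inferInstance, A, hA⟩

variable {ι : Type} [Fintype ι] {α β : ι → Type*}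

/-- The tensor product of a family of rectangular matrices. -/
def tensorRect (X : ∀ k, Matrix (β k) (α k) ℂ) :
    Matrix (∀ k, β k) (∀ k, α k) ℂ :=
  Matrix.of fun p q => ∏ k, X k (p k) (q k)

theorem tensorRect_conjTranspose_mul [DecidableEq ι] [∀ k, Fintype (β k)]
    (X Y : ∀ k, Matrix (β k) (α k) ℂ) :
    (tensorRect X)ᴴ * tensorRect Y = tensorMatrix fun k => (X k)ᴴ * Y k := by
  ext p q
  simp only [tensorRect, tensorMatrix, Matrix.mul_apply, Matrix.conjTranspose_apply,
    Matrix.of_apply, star_prod, ← Finset.prod_mul_distrib, Finset.prod_univ_sum,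
    Fintype.piFinset_univ]

theorem tensorMatrix_mul [DecidableEq ι] [∀ k, Fintype (α k)]
    (X Y : ∀ k, Matrix (α k) (α k) ℂ) :
    tensorMatrix X * tensorMatrix Y = tensorMatrix fun k => X k * Y k := by
  ext p q
  simp only [tensorMatrix, Matrix.mul_apply, Matrix.of_apply, ← Finset.prod_mul_distrib,
    Finset.prod_univ_sum, Fintype.piFinset_univ]

theorem tensorMatrix_conjTranspose (X : ∀ k, Matrix (α k) (α k) ℂ) :
    (tensorMatrix X)ᴴ = tensorMatrix fun k => (X k)ᴴ := by
  ext p q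
  simp [tensorMatrix]

theorem tensorMatrix_one [∀ k, DecidableEq (α k)] :
    (tensorMatrix fun k => (1 : Matrix (α k) (α k) ℂ)) = 1 := by
  ext p q
  simp only [tensorMatrix, Matrix.of_apply, Matrix.one_apply, Finset.prod_ite_zero, funext_iff]
  simp

/-- Tensor products are multilinear. -/
theorem tensorMatrix_sum_smul [DecidableEq ι] {ε : ι → Type*} [∀ k, Fintype (ε k)]
    (c : ∀ k, ε k → ℂ)
    (X : ∀ k, ε k → Matrix (α k) (α k) ℂ) :
    (tensorMatrix fun k => ∑ e, c k e • X k e) =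
      ∑ e : ∀ k, ε k, (∏ k, c k (e k)) • tensorMatrix fun k => X k (e k) := by
  ext p q
  simp only [tensorMatrix, Matrix.of_apply, Matrix.sum_apply, Matrix.smul_apply, smul_eq_mul,
    Finset.prod_univ_sum, Fintype.piFinset_univ, Finset.prod_mul_distrib]

variable [DecidableEq ι] [∀ k, Fintype (α k)] [∀ k, DecidableEq (α k)] [∀ k, Fintype (β k)]

theorem isKraus_tensorChannel {ε : ι → Type*} [∀ k, Fintype (ε k)]
    {Φ : ∀ k, Matrix (α k) (α k) ℂ →ₗ[ℂ] Matrix (β k) (β k) ℂ}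
    {A : ∀ k, ε k → Matrix (β k) (α k) ℂ} (h : ∀ k, IsKraus (Φ k) (A k)) :
    IsKraus (tensorChannel Φ) (fun e : ∀ k, ε k => tensorRect fun k => A k (e k)) := by
  refine ⟨fun ρ => ?_, ?_⟩
  · ext p q
    have hent : ∀ i j : ∀ k, α k, ∏ k, Φ k (Matrix.single (i k) (j k) 1) (p k) (q k) =
        ∑ e : ∀ k, ε k, (∏ k, A k (e k) (p k) (i k)) *
          star (∏ k, A k (e k) (q k) (j k)) := by
      intro i j
      have : ∀ k, Φ k (Matrix.single (i k) (j k) 1) (p k) (q k) =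
          ∑ e, A k e (p k) (i k) * star (A k e (q k) (j k)) := by
        intro k
        rw [(h k).1]
        simp [Matrix.sum_apply, Matrix.mul_apply, Matrix.single_apply, ite_and]
      simp only [this, Finset.prod_univ_sum, Fintype.piFinset_univ, star_prod,
        Finset.prod_mul_distrib]
    simp only [tensorChannel, LinearMap.coe_mk, AddHom.coe_mk, tensorMatrix, tensorRect,
      Matrix.sum_apply, Matrix.smul_apply, Matrix.of_apply, smul_eq_mul, hent,
      Matrix.mul_apply, Matrix.conjTranspose_apply, Finset.mul_sum, Finset.sum_mul]
    rw [Finset.sum_comm]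
    rw [Finset.sum_congr rfl fun j _ => Finset.sum_comm, Finset.sum_comm]
    exact Finset.sum_congr rfl fun s _ => Finset.sum_congr rfl fun j _ =>
      Finset.sum_congr rfl fun i _ => by ring
  · have h1 := tensorMatrix_sum_smul (fun k (_ : ε k) => 1) fun k e => (A k e)ᴴ * A k e
    simp only [one_smul, (h _).2, tensorMatrix_one, Finset.prod_const_one] at h1
    simp only [tensorRect_conjTranspose_mul, ← h1]

/-- The noncommutative graph of a tensor product is spanned by the products of elements of the
graphs of the factors. -/
theorem SpansGraph.tensorChannel {Φ : ∀ k, Matrix (α k) (α k) ℂ →ₗ[ℂ] Matrix (β k) (β k) ℂ}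
    {L : ∀ k, Set (Matrix (α k) (α k) ℂ)} (h : ∀ k, SpansGraph (Φ k) (L k)) :
    SpansGraph (tensorChannel Φ) {N | ∃ M, (∀ k, M k ∈ L k) ∧ N = tensorMatrix M} := by
  choose ε hε A hA hAL hLA using h
  refine ⟨∀ k, ε k, inferInstance, fun e => tensorRect fun k => A k (e k),
    isKraus_tensorChannel hA, fun e e' => ⟨fun k => (A k (e k))ᴴ * A k (e' k),
      fun k => hAL k _ _, tensorRect_conjTranspose_mul _ _⟩, ?_⟩
  rintro _ ⟨M, hM, rfl⟩
  choose X hX using fun k => hLA k (M k) (hM k)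
  refine ⟨fun e e' => ∏ k, X k (e k) (e' k), ?_⟩
  have h1 : M = fun k => ∑ e, (1 : ℂ) • ∑ e', X k e e' • ((A k e)ᴴ * A k e') := by
    funext k; simpa using hX k
  conv_lhs => rw [h1]
  rw [tensorMatrix_sum_smul]
  refine Finset.sum_congr rfl fun e _ => ?_
  rw [tensorMatrix_sum_smul, Finset.prod_const_one, one_smul]
  simp only [tensorRect_conjTranspose_mul]

end Tensor

/-! ### Codes and capacities in terms of a spanning set of the graph -/

section Capacity

variable {α β : Type*} [Fintype α] [DecidableEq α] [Fintype β]
  {Φ : Matrix α α ℂ →ₗ[ℂ] Matrix β β ℂ} {S : Set (Matrix α α ℂ)}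

theorem dotProduct_sum_smul_mulVec {α ε : Type*} [Fintype α] [Fintype ε] (X : ε → ε → ℂ)
    (N : ε → ε → Matrix α α ℂ) (φ ψ : α → ℂ) :
    φ ⬝ᵥ ((∑ e, ∑ e', X e e' • N e e') *ᵥ ψ) = ∑ e, ∑ e', X e e' * (φ ⬝ᵥ (N e e' *ᵥ ψ)) := by
  simp only [Matrix.sum_mulVec, dotProduct_sum, Matrix.smul_mulVec, dotProduct_smul, smul_eq_mul]

theorem SpansGraph.dotProduct_eq (h : SpansGraph Φ S)
    {K : Submodule ℂ (EuclideanSpace ℂ α)} (hK : IsErrorCorrectingCode Φ K) {φ ψ : α → ℂ}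
    (hφK : WithLp.toLp 2 φ ∈ K) (hψK : WithLp.toLp 2 ψ ∈ K)
    (hφ : star φ ⬝ᵥ φ = 1) (hψ : star ψ ⬝ᵥ ψ = 1) (hφψ : star φ ⬝ᵥ ψ = 0) :
    ∀ M ∈ S, star φ ⬝ᵥ (M *ᵥ ψ) = 0 ∧ star φ ⬝ᵥ (M *ᵥ φ) = star ψ ⬝ᵥ (M *ᵥ ψ) := by
  obtain ⟨ε, _, A, hA, -, hS⟩ := h
  intro M hM
  obtain ⟨X, rfl⟩ := hS M hM
  have key := hK.dotProduct_eq hA hφK hψK hφ hψ hφψ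
  simp only [dotProduct_sum_smul_mulVec, (key _ _).1, (key _ _).2, mul_zero,
    Finset.sum_const_zero, and_self]

theorem SpansGraph.isErrorCorrectingCode (h : SpansGraph Φ S) {φ ψ : EuclideanSpace ℂ α}
    (hφ : star φ.ofLp ⬝ᵥ φ.ofLp = 1) (hψ : star ψ.ofLp ⬝ᵥ ψ.ofLp = 1)
    (hφψ : star φ.ofLp ⬝ᵥ ψ.ofLp = 0)
    (hS : ∀ M ∈ S, star φ.ofLp ⬝ᵥ (M *ᵥ ψ.ofLp) = 0 ∧ star ψ.ofLp ⬝ᵥ (M *ᵥ φ.ofLp) = 0 ∧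
      star φ.ofLp ⬝ᵥ (M *ᵥ φ.ofLp) = star ψ.ofLp ⬝ᵥ (M *ᵥ ψ.ofLp)) :
    IsErrorCorrectingCode Φ (Submodule.span ℂ {φ, ψ}) := by
  obtain ⟨ε, _, A, hA, hAS, -⟩ := h
  exact isErrorCorrectingCode_span_pair hA hφ hψ hφψ fun e e' => hS _ (hAS e e')

theorem inner_eq_star_dotProduct {α : Type*} [Fintype α] (φ ψ : EuclideanSpace ℂ α) :
    inner ℂ φ ψ = star φ.ofLp ⬝ᵥ ψ.ofLp := by
  rw [EuclideanSpace.inner_eq_star_dotProduct, dotProduct_comm]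

theorem finrank_span_pair {α : Type*} [Fintype α] {φ ψ : EuclideanSpace ℂ α}
    (hφ : star φ.ofLp ⬝ᵥ φ.ofLp = 1) (hψ : star ψ.ofLp ⬝ᵥ ψ.ofLp = 1)
    (hφψ : star φ.ofLp ⬝ᵥ ψ.ofLp = 0) :
    Module.finrank ℂ (Submodule.span ℂ {φ, ψ}) = 2 := by
  have hon : Orthonormal ℂ ![φ, ψ] := by
    rw [orthonormal_iff_ite]
    have hψφ : star ψ.ofLp ⬝ᵥ φ.ofLp = 0 := by rw [Matrix.star_dotProduct, hφψ, star_zero]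
    intro i j
    rw [inner_eq_star_dotProduct]
    fin_cases i <;> fin_cases j <;> simp [hφ, hψ, hφψ, hψφ]
  have := finrank_span_eq_card hon.linearIndependent
  rw [← Matrix.range_cons_cons_empty φ ψ ![], this, Fintype.card_fin]

theorem exists_orthonormal_pair {α : Type*} [Fintype α] {K : Submodule ℂ (EuclideanSpace ℂ α)}
    (hK : 2 ≤ Module.finrank ℂ K) : ∃ φ ψ : α → ℂ, WithLp.toLp 2 φ ∈ K ∧ WithLp.toLp 2 ψ ∈ K ∧
      star φ ⬝ᵥ φ = 1 ∧ star ψ ⬝ᵥ ψ = 1 ∧ star φ ⬝ᵥ ψ = 0 := by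
  let b := stdOrthonormalBasis ℂ K
  have hb := orthonormal_iff_ite.1 b.orthonormal
  let i : Fin (Module.finrank ℂ K) := ⟨0, by omega⟩
  let j : Fin (Module.finrank ℂ K) := ⟨1, by omega⟩
  have hij : i ≠ j := by simp [i, j]
  have h : ∀ i j, star (b i).1.ofLp ⬝ᵥ (b j).1.ofLp = if i = j then (1 : ℂ) else 0 := by
    intro i j
    rw [← inner_eq_star_dotProduct, ← hb]
    rfl
  exact ⟨(b i).1.ofLp, (b j).1.ofLp, (b i).2, (b j).2, by simp [h], by simp [h], by simp [h, hij]⟩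

theorem le_oneShotCapacity {K : Submodule ℂ (EuclideanSpace ℂ α)} (hK : IsErrorCorrectingCode Φ K)
    (h2 : Module.finrank ℂ K = 2) : 1 ≤ oneShotCapacity Φ := by
  refine le_csSup ⟨Real.logb 2 (Fintype.card α), ?_⟩ ⟨K, ?_, hK, ?_⟩
  · rintro _ ⟨K, hK, -, rfl⟩
    refine Real.logb_le_logb_of_le (by norm_num) ?_ ?_
    · exact_mod_cast Module.finrank_pos_iff.2 (Submodule.nontrivial_iff_ne_bot.2 hK)
    · have := Submodule.finrank_le K
      rw [finrank_euclideanSpace] at this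
      exact_mod_cast this
  · rintro rfl; simp at h2
  · rw [h2]; norm_num

theorem oneShotCapacity_le_one
    (h : ∀ K : Submodule ℂ (EuclideanSpace ℂ α), IsErrorCorrectingCode Φ K →
      Module.finrank ℂ K ≤ 2) : oneShotCapacity Φ ≤ 1 := by
  refine Real.sSup_le ?_ zero_le_one
  rintro _ ⟨K, hK, hcode, rfl⟩
  have h1 : (1 : ℝ) = Real.logb 2 2 := by simp
  rw [h1]
  refine Real.logb_le_logb_of_le (by norm_num) ?_ ?_
  · exact_mod_cast Module.finrank_pos_iff.2 (Submodule.nontrivial_iff_ne_bot.2 hK)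
  · exact_mod_cast h K hcode

theorem SpansGraph.oneShotCapacity_eq_zero (hS : SpansGraph Φ S)
    (h : ∀ φ ψ : α → ℂ, star φ ⬝ᵥ φ = 1 → star ψ ⬝ᵥ ψ = 1 → star φ ⬝ᵥ ψ = 0 →
      (∀ M ∈ S, star φ ⬝ᵥ (M *ᵥ ψ) = 0 ∧ star φ ⬝ᵥ (M *ᵥ φ) = star ψ ⬝ᵥ (M *ᵥ ψ)) → False) :
    oneShotCapacity Φ = 0 := by
  have h0 : ∀ r ∈ {r : ℝ | ∃ K : Submodule ℂ (EuclideanSpace ℂ α), K ≠ ⊥ ∧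
      IsErrorCorrectingCode Φ K ∧ r = Real.logb 2 (Module.finrank ℂ K)}, r = 0 := by
    rintro _ ⟨K, hK, hcode, rfl⟩
    have h1 : 0 < Module.finrank ℂ K :=
      Module.finrank_pos_iff.2 (Submodule.nontrivial_iff_ne_bot.2 hK)
    have h2 : ¬ 2 ≤ Module.finrank ℂ K := by
      intro h2
      obtain ⟨φ, ψ, hφK, hψK, hφ, hψ, hφψ⟩ := exists_orthonormal_pair h2
      exact h φ ψ hφ hψ hφψ (hS.dotProduct_eq hcode hφK hψK hφ hψ hφψ)
    have h3 : Module.finrank ℂ K = 1 := by omega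
    simp [h3]
  exact le_antisymm (Real.sSup_nonpos fun r hr => (h0 r hr).le)
    (Real.sSup_nonneg fun r hr => (h0 r hr).ge)

end Capacity

/-! ### The explicit two-dimensional codes -/

section Codes

/-- The linear relations between the entries of an element of `𝔏_θ`, in terms of its first row and
of the parameter `c`. -/
theorem exists_entries_of_mem_graphL {θ : ℝ} {M : Matrix (Fin 4) (Fin 4) ℂ} (h : M ∈ graphL θ) :
    ∃ c : ℂ, M 1 1 = M 0 0 ∧ M 2 2 = M 0 0 ∧ M 3 3 = M 0 0 ∧ M 1 0 = M 0 1 ∧ M 2 3 = M 0 1 ∧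
      M 3 2 = M 0 1 ∧ M 1 2 = M 0 3 ∧ M 2 1 = M 0 3 ∧ M 3 0 = M 0 3 ∧ M 0 2 = gam θ * c ∧
      M 1 3 = star (gam θ) * c ∧ M 2 0 = star (gam θ) * c ∧ M 3 1 = gam θ * c := by
  obtain ⟨a, b, c, d, rfl⟩ := h
  exact ⟨c, by simp⟩

theorem one_mem_graphL (θ : ℝ) : 1 ∈ graphL θ := by
  refine ⟨1, 0, 0, 0, ?_⟩
  ext i j
  fin_cases i <;> fin_cases j <;> simp

theorem W4_mem_graphL (θ : ℝ) : W4 ∈ graphL θ := by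
  refine ⟨0, 0, 0, 1, ?_⟩
  simp [W4]

theorem W4_mul_W4 : W4 * W4 = 1 := by
  ext i j
  fin_cases i <;> fin_cases j <;> simp [W4, Matrix.mul_apply, Fin.sum_univ_four]

theorem W4_conjTranspose : W4ᴴ = W4 := by
  ext i j
  fin_cases i <;> fin_cases j <;> simp [W4]

theorem W4_conj_of_mem_graphL {θ : ℝ} {M : Matrix (Fin 4) (Fin 4) ℂ} (h : M ∈ graphL θ) :
    W4 * M * W4 = M := by
  obtain ⟨a, b, c, d, rfl⟩ := h
  ext i j
  fin_cases i <;> fin_cases j <;> simp [W4, Matrix.mul_apply, Fin.sum_univ_four]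

theorem U_conj_of_mem_graphL {θ : ℝ} {M : Matrix (Fin 4) (Fin 4) ℂ} (h : M ∈ graphL θ)
    (x : Fin 2) : (U x)ᴴ * M * U x = M := by
  fin_cases x
  · simp [U]
  · simp [U, W4_conjTranspose, W4_conj_of_mem_graphL h]

theorem U_mul_U (x y : Fin 2) : (U x)ᴴ * U y = if x = y then 1 else W4 := by
  fin_cases x <;> fin_cases y <;> simp [U, W4_conjTranspose, W4_mul_W4]

theorem prod_gam {ι : Type*} [Fintype ι] (θ : ι → ℝ) : ∏ k, gam (θ k) = gam (∑ k, θ k) := by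
  simp only [gam, ← Complex.exp_sum, Complex.ofReal_sum, Finset.mul_sum]

theorem gam_add_star_gam (θ : ℝ) : gam θ + star (gam θ) = 2 * Real.cos (θ / 2) := by
  have h : gam θ = Complex.exp ((θ / 2 : ℝ) * Complex.I) := by
    rw [gam]; congr 1; push_cast; ring
  rw [h, Complex.star_def, Complex.add_conj, Complex.exp_ofReal_mul_I_re]
  push_cast; ring

theorem gam_add_star_gam_eq_zero {θ : ℝ} (h : ∃ m : ℤ, θ = Real.pi + 2 * Real.pi * m) :
    gam θ + star (gam θ) = 0 := by
  obtain ⟨m, rfl⟩ := h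
  rw [gam_add_star_gam]
  have : Real.cos ((Real.pi + 2 * Real.pi * m) / 2) = 0 :=
    Real.cos_eq_zero_iff.2 ⟨m, by ring⟩
  simp [this]

/-- The vector `(|x⟩ + i |y⟩) / √2`. -/
noncomputable def catState {α : Type*} [DecidableEq α] (x y : α) : EuclideanSpace ℂ α :=
  ((1 / Real.sqrt 2 : ℝ) : ℂ) •
    (EuclideanSpace.single x (1 : ℂ) + Complex.I • EuclideanSpace.single y (1 : ℂ))

theorem catState_form {α : Type*} [Fintype α] [DecidableEq α] (N : Matrix α α ℂ) (x y z w : α) :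
    star (catState x y).ofLp ⬝ᵥ (N *ᵥ (catState z w).ofLp) =
      1 / 2 * (N x z + Complex.I * N x w - Complex.I * N y z + N y w) := by
  have h2 : ((1 / Real.sqrt 2 : ℝ) : ℂ) * ((1 / Real.sqrt 2 : ℝ) : ℂ) = 1 / 2 := by
    rw [← Complex.ofReal_mul, div_mul_div_comm, Real.mul_self_sqrt (by norm_num)]
    norm_num
  simp only [catState, WithLp.ofLp_smul, WithLp.ofLp_add, PiLp.ofLp_single, star_smul, star_add,
    smul_dotProduct, add_dotProduct, Matrix.mulVec_smul, Matrix.mulVec_add, dotProduct_smul,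
    dotProduct_add, smul_eq_mul, Matrix.mulVec_single_one, Pi.star_single, star_one,
    single_one_dotProduct, Matrix.col_apply, Complex.star_def, Complex.conj_ofReal, Complex.conj_I]
  linear_combination (N x z + Complex.I * N x w - Complex.I * N y z + N y w) * h2 -
    ((1 / Real.sqrt 2 : ℝ) : ℂ) * ((1 / Real.sqrt 2 : ℝ) : ℂ) * N y w * Complex.I_mul_I

/-- The two cat vectors satisfy the Knill–Laflamme conditions for an operator whose entries have
the pattern of a tensor product of elements of the graphs, if the two phases cancel. -/
theorem catState_conditions {α : Type*} [Fintype α] [DecidableEq α] {N : Matrix α α ℂ}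
    {p q r s : α} (h₁ : N q q = N p p) (h₂ : N r r = N p p) (h₃ : N s s = N p p)
    (h₄ : N q p = N p q) (h₅ : N s r = N r s) (h₆ : N p s = N q r) (h₇ : N r q = N s p)
    (h₈ : N p r + N q s = 0) (h₉ : N r p + N s q = 0) :
    star (catState p q).ofLp ⬝ᵥ (N *ᵥ (catState r s).ofLp) = 0 ∧
    star (catState r s).ofLp ⬝ᵥ (N *ᵥ (catState p q).ofLp) = 0 ∧
    star (catState p q).ofLp ⬝ᵥ (N *ᵥ (catState p q).ofLp) = N p p ∧
    star (catState r s).ofLp ⬝ᵥ (N *ᵥ (catState r s).ofLp) = N p p := by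
  simp only [catState_form]
  refine ⟨?_, ?_, ?_, ?_⟩
  · linear_combination 1 / 2 * h₈ + 1 / 2 * Complex.I * h₆
  · linear_combination 1 / 2 * h₉ + 1 / 2 * Complex.I * h₇
  · linear_combination 1 / 2 * h₁ - 1 / 2 * Complex.I * h₄
  · linear_combination 1 / 2 * h₂ + 1 / 2 * h₃ - 1 / 2 * Complex.I * h₅

theorem graphL_conditions {θ : ℝ} (hθ : gam θ + star (gam θ) = 0)
    {M : Matrix (Fin 4) (Fin 4) ℂ} (h : M ∈ graphL θ) :
    star (catState 0 1).ofLp ⬝ᵥ (M *ᵥ (catState 2 3).ofLp) = 0 ∧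
    star (catState 2 3).ofLp ⬝ᵥ (M *ᵥ (catState 0 1).ofLp) = 0 ∧
    star (catState 0 1).ofLp ⬝ᵥ (M *ᵥ (catState 0 1).ofLp) = M 0 0 ∧
    star (catState 2 3).ofLp ⬝ᵥ (M *ᵥ (catState 2 3).ofLp) = M 0 0 := by
  obtain ⟨c, h11, h22, h33, h10, h23, h32, h12, h21, h30, h02, h13, h20, h31⟩ :=
    exists_entries_of_mem_graphL h
  refine catState_conditions h11 h22 h33 h10 (h32.trans h23.symm) h12.symm (h21.trans h30.symm)
    ?_ ?_
  · rw [h02, h13]; linear_combination c * hθ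
  · rw [h20, h31]; linear_combination c * hθ

theorem tensor_graphL_conditions {n : ℕ} {θ : Fin n → ℝ}
    (hθ : gam (∑ k, θ k) + star (gam (∑ k, θ k)) = 0)
    {M : Fin n → Matrix (Fin 4) (Fin 4) ℂ} (h : ∀ k, M k ∈ graphL (θ k)) :
    star (catVec n 0 1).ofLp ⬝ᵥ (tensorMatrix M *ᵥ (catVec n 2 3).ofLp) = 0 ∧
    star (catVec n 2 3).ofLp ⬝ᵥ (tensorMatrix M *ᵥ (catVec n 0 1).ofLp) = 0 ∧
    star (catVec n 0 1).ofLp ⬝ᵥ (tensorMatrix M *ᵥ (catVec n 0 1).ofLp) = ∏ k, M k 0 0 ∧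
    star (catVec n 2 3).ofLp ⬝ᵥ (tensorMatrix M *ᵥ (catVec n 2 3).ofLp) = ∏ k, M k 0 0 := by
  choose c h11 h22 h33 h10 h23 h32 h12 h21 h30 h02 h13 h20 h31 using
    fun k => exists_entries_of_mem_graphL (h k)
  have hθ' : (∏ k, gam (θ k)) + ∏ k, star (gam (θ k)) = 0 := by
    rw [← star_prod, prod_gam, hθ]
  refine catState_conditions (N := tensorMatrix M) (p := fun _ => 0) (q := fun _ => 1)
    (r := fun _ => 2) (s := fun _ => 3) ?_ ?_ ?_ ?_ ?_ ?_ ?_ ?_ ?_ <;>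
    simp only [tensorMatrix, Matrix.of_apply, h11, h22, h33, h10, h23, h32, h12, h21, h30, h02,
      h13, h20, h31, Finset.prod_mul_distrib] <;>
    linear_combination (∏ k, c k) * hθ'

/-- The image of a cat vector under `U_{x₁} ⊗ … ⊗ U_{xₙ}`. -/
noncomputable def rotCat {n : ℕ} (x : Fin n → Fin 2) (p q : Fin 4) :
    EuclideanSpace ℂ (Fin n → Fin 4) :=
  (tensorMatrix fun k => U (x k)).toEuclideanLin (catVec n p q)

theorem rotCat_form {n : ℕ} (x y : Fin n → Fin 2) (p q r s : Fin 4)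
    (M : Fin n → Matrix (Fin 4) (Fin 4) ℂ) :
    star (rotCat x p q).ofLp ⬝ᵥ (tensorMatrix M *ᵥ (rotCat y r s).ofLp) =
      star (catVec n p q).ofLp ⬝ᵥ
        ((tensorMatrix fun k => (U (x k))ᴴ * M k * U (y k)) *ᵥ (catVec n r s).ofLp) := by
  simp only [rotCat, Matrix.ofLp_toLpLin, Matrix.toLin'_apply]
  rw [Matrix.star_mulVec, ← Matrix.dotProduct_mulVec, Matrix.mulVec_mulVec, Matrix.mulVec_mulVec,
    tensorMatrix_conjTranspose, tensorMatrix_mul, tensorMatrix_mul]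

theorem rotCat_inner {n : ℕ} {θ : ℝ} (hθ : gam θ + star (gam θ) = 0) (x y : Fin n → Fin 2)
    {ϑ : Fin n → ℝ} (hϑ : ∑ k, ϑ k = θ) :
    star (rotCat x 0 1).ofLp ⬝ᵥ (rotCat y 2 3).ofLp = 0 ∧
    star (rotCat x 2 3).ofLp ⬝ᵥ (rotCat y 0 1).ofLp = 0 ∧
    star (rotCat x 0 1).ofLp ⬝ᵥ (rotCat y 0 1).ofLp = (if x = y then 1 else 0) ∧
    star (rotCat x 2 3).ofLp ⬝ᵥ (rotCat y 2 3).ofLp = (if x = y then 1 else 0) := by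
  have h1 : ∀ v : EuclideanSpace ℂ (Fin n → Fin 4), v.ofLp =
      (tensorMatrix fun _ : Fin n => (1 : Matrix (Fin 4) (Fin 4) ℂ)) *ᵥ v.ofLp := by
    intro v; rw [tensorMatrix_one, Matrix.one_mulVec]
  have hM : ∀ k, (U (x k))ᴴ * 1 * U (y k) ∈ graphL (ϑ k) := by
    intro k
    rw [Matrix.mul_one, U_mul_U]
    split_ifs
    · exact one_mem_graphL _
    · exact W4_mem_graphL _
  have hprod : ∏ k, ((U (x k))ᴴ * (1 : Matrix (Fin 4) (Fin 4) ℂ) * U (y k)) 0 0 =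
      if x = y then (1 : ℂ) else 0 := by
    simp only [Matrix.mul_one, U_mul_U]
    split_ifs with hxy
    · subst hxy; simp
    · obtain ⟨k, hk⟩ := Function.ne_iff.1 hxy
      exact Finset.prod_eq_zero (Finset.mem_univ k) (by simp [hk, W4])
  have key := tensor_graphL_conditions (hϑ.symm ▸ hθ) hM
  rw [hprod] at key
  rw [h1 (rotCat y 0 1), h1 (rotCat y 2 3)]
  simp only [rotCat_form]
  exact key

variable {n : ℕ} {θ : Fin n → ℝ} {β : Fin n → Type u} [∀ k, Fintype (β k)]
  {Φ : ∀ k, Matrix (Fin 4) (Fin 4) ℂ →ₗ[ℂ] Matrix (β k) (β k) ℂ}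

theorem isErrorCorrectingCode_code (hΦ : ∀ k, InClassL (θ k) (Φ k))
    (hθ : gam (∑ k, θ k) + star (gam (∑ k, θ k)) = 0) (x : Fin n → Fin 2) :
    IsErrorCorrectingCode (tensorChannel Φ) (code x) ∧ Module.finrank ℂ (code x) = 2 := by
  obtain ⟨h1, h2, h3, h4⟩ := rotCat_inner hθ x x rfl
  rw [if_pos rfl] at h3 h4
  refine ⟨(SpansGraph.tensorChannel fun k => (hΦ k).2.spansGraph).isErrorCorrectingCode
    (φ := rotCat x 0 1) (ψ := rotCat x 2 3) h3 h4 h1 ?_, finrank_span_pair h3 h4 h1⟩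
  rintro _ ⟨M, hM, rfl⟩
  simp only [rotCat_form, fun k => U_conj_of_mem_graphL (hM k) (x k)]
  obtain ⟨e1, e2, e3, e4⟩ := tensor_graphL_conditions hθ hM
  exact ⟨e1, e2, e3.trans e4.symm⟩

theorem code_isOrtho (hθ : gam (∑ k, θ k) + star (gam (∑ k, θ k)) = 0) {x y : Fin n → Fin 2}
    (hxy : x ≠ y) : code x ⟂ code y := by
  obtain ⟨h1, h2, h3, h4⟩ := rotCat_inner hθ x y rfl
  rw [if_neg hxy] at h3 h4
  rw [code, code, Submodule.isOrtho_span]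
  intro u hu v hv
  rw [inner_eq_star_dotProduct]
  rcases hu with rfl | rfl <;> rcases hv with rfl | rfl
  exacts [h3, h1, h2, h4]

theorem isErrorCorrectingCode_pi {β : Type u} [Fintype β]
    {Φ : Matrix (Fin 4) (Fin 4) ℂ →ₗ[ℂ] Matrix β β ℂ} (hΦ : InClassL Real.pi Φ) :
    ∃ K, IsErrorCorrectingCode Φ K ∧ Module.finrank ℂ K = 2 := by
  have hθ : gam Real.pi + star (gam Real.pi) = 0 := gam_add_star_gam_eq_zero ⟨0, by simp⟩
  obtain ⟨h1, -, h3, h4⟩ := graphL_conditions hθ (one_mem_graphL Real.pi)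
  simp only [Matrix.one_mulVec, Matrix.one_apply_eq] at h1 h3 h4
  refine ⟨Submodule.span ℂ {catState 0 1, catState 2 3},
    hΦ.2.spansGraph.isErrorCorrectingCode h3 h4 h1 fun M hM => ?_, finrank_span_pair h3 h4 h1⟩
  obtain ⟨e1, e2, e3, e4⟩ := graphL_conditions hθ hM
  exact ⟨e1, e2, e3.trans e4.symm⟩

end Codes

/-! ### Codes of a single channel -/

section OneChannel

theorem mul_conjTranspose_eq_smul_one {m : Type*} [Fintype m] [DecidableEq m] {A : Matrix m m ℂ}
    {l : ℂ} (h : Aᴴ * A = l • 1) : A * Aᴴ = l • 1 := by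
  by_cases hl : l = 0
  · rw [hl, zero_smul] at h
    rw [Matrix.conjTranspose_mul_self_eq_zero.1 h, hl]; simp
  · have h1 : (l⁻¹ • Aᴴ) * A = 1 := by
      rw [Matrix.smul_mul, h, smul_smul, inv_mul_cancel₀ hl, one_smul]
    have h2 := mul_eq_one_comm.1 h1
    rw [Matrix.mul_smul] at h2
    rw [← h2, smul_smul, mul_inv_cancel₀ hl, one_smul]

/-- If `A` and `F` are the two components of an isometry, both of them scaled unitaries, then the
traceless operators in the hypotheses are compressed to scalars only if they are compressed to zero.
Squaring the first resulting identity gives equal weights of `A` and `F`; anticommuting the second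
one with the first removes the term with `y`. -/
theorem eq_zero_of_compressions {m : Type*} [Fintype m] [DecidableEq m] [Nonempty m]
    {A F z y : Matrix m m ℂ} {α s b c d : ℂ}
    (hz : z * z = 1) (hzy : z * y + y * z = 0) (tz : z.trace = 0) (ty : y.trace = 0)
    (h1 : Aᴴ * A + Fᴴ * F = 1) (h2 : Aᴴ * A - Fᴴ * F = d • 1)
    (h3 : Aᴴ * z * A - Fᴴ * z * F = b • 1)
    (h4 : α • (Aᴴ * z * A + Fᴴ * z * F) + s • (Aᴴ * y * A + Fᴴ * y * F) = c • 1) : α = 0 := by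
  have hcard : (Fintype.card m : ℂ) ≠ 0 := by exact_mod_cast Fintype.card_ne_zero
  have smul_inj : ∀ x y : ℂ, x • (1 : Matrix m m ℂ) = y • 1 → x = y := by
    intro x y h
    obtain ⟨i⟩ := ‹Nonempty m›
    simpa using congrFun (congrFun h i) i
  obtain ⟨l, hl⟩ : ∃ l : ℂ, Aᴴ * A = l • 1 := ⟨(1 + d) / 2, by
    have : Aᴴ * A = (1 / 2 : ℂ) • ((Aᴴ * A + Fᴴ * F) + (Aᴴ * A - Fᴴ * F)) := by module
    rw [this, h1, h2]; module⟩
  obtain ⟨k, hk⟩ : ∃ k : ℂ, Fᴴ * F = k • 1 := ⟨(1 - d) / 2, by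
    have : Fᴴ * F = (1 / 2 : ℂ) • ((Aᴴ * A + Fᴴ * F) - (Aᴴ * A - Fᴴ * F)) := by module
    rw [this, h1, h2]; module⟩
  have hlk : l + k = 1 := smul_inj _ _ (by rw [add_smul, ← hl, ← hk, h1, one_smul])
  have hl' := mul_conjTranspose_eq_smul_one hl
  have hk' := mul_conjTranspose_eq_smul_one hk
  have tr : ∀ (B w : Matrix m m ℂ) (r : ℂ), B * Bᴴ = r • 1 → w.trace = 0 →
      (Bᴴ * w * B).trace = 0 := by
    intro B w r hB hw
    rw [Matrix.trace_mul_comm, ← Matrix.mul_assoc, hB, Matrix.smul_mul, Matrix.one_mul,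
      Matrix.trace_smul, hw, smul_zero]
  have mulc : ∀ (B v w : Matrix m m ℂ) (r : ℂ), B * Bᴴ = r • 1 →
      (Bᴴ * v * B) * (Bᴴ * w * B) = r • (Bᴴ * (v * w) * B) := by
    intro B v w r hB
    have : (Bᴴ * v * B) * (Bᴴ * w * B) = Bᴴ * v * (B * Bᴴ) * w * B := by
      simp only [Matrix.mul_assoc]
    rw [this, hB]
    simp only [Matrix.mul_smul, Matrix.smul_mul, Matrix.mul_one, Matrix.mul_assoc]
  have hb : b = 0 := by
    have := congrArg Matrix.trace h3
    rw [Matrix.trace_sub, tr A z l hl' tz, tr F z k hk' tz, Matrix.trace_smul,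
      Matrix.trace_one, smul_eq_mul, sub_zero] at this
    exact (mul_eq_zero.1 this.symm).resolve_right hcard
  have hc : c = 0 := by
    have := congrArg Matrix.trace h4
    simp only [Matrix.trace_add, Matrix.trace_smul, tr A z l hl' tz, tr F z k hk' tz,
      tr A y l hl' ty, tr F y k hk' ty, Matrix.trace_one, smul_eq_mul, add_zero, mul_zero] at this
    exact (mul_eq_zero.1 this.symm).resolve_right hcard
  rw [hb, zero_smul, sub_eq_zero] at h3
  have sqA : (Aᴴ * z * A) * (Aᴴ * z * A) = (l * l) • 1 := by
    rw [mulc A z z l hl', hz, Matrix.mul_one, hl, smul_smul]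
  have sqF : (Fᴴ * z * F) * (Fᴴ * z * F) = (k * k) • 1 := by
    rw [mulc F z z k hk', hz, Matrix.mul_one, hk, smul_smul]
  have hlk2 : l * l = k * k := smul_inj _ _ (by rw [← sqA, ← sqF, h3])
  have hl2 : l = 1 / 2 := by linear_combination (1 / 2) * hlk2 + (1 / 2) * (1 - l + k) * hlk
  have anti : ∀ (B : Matrix m m ℂ) (r : ℂ), B * Bᴴ = r • 1 →
      (Bᴴ * z * B) * (Bᴴ * y * B) + (Bᴴ * y * B) * (Bᴴ * z * B) = 0 := by
    intro B r hB
    rw [mulc B z y r hB, mulc B y z r hB, ← smul_add, ← Matrix.add_mul, ← Matrix.mul_add, hzy]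
    simp
  have aA := anti A l hl'
  have aF := anti F k hk'
  rw [← h3] at aF h4
  rw [hc, zero_smul] at h4
  set P := Aᴴ * z * A
  have h5 : (4 * α) • (P * P) = 0 := by
    have e : P * (α • (P + P) + s • (Aᴴ * y * A + Fᴴ * y * F)) +
        (α • (P + P) + s • (Aᴴ * y * A + Fᴴ * y * F)) * P = 0 := by rw [h4]; simp
    have e' : P * (α • (P + P) + s • (Aᴴ * y * A + Fᴴ * y * F)) +
        (α • (P + P) + s • (Aᴴ * y * A + Fᴴ * y * F)) * P = (4 * α) • (P * P) +
        s • ((P * (Aᴴ * y * A) + Aᴴ * y * A * P) + (P * (Fᴴ * y * F) + Fᴴ * y * F * P)) := by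
      simp only [Matrix.mul_add, Matrix.add_mul, Matrix.mul_smul, Matrix.smul_mul]
      module
    rw [e', aA, aF] at e
    simpa using e
  rw [sqA, smul_smul, ← zero_smul ℂ (1 : Matrix m m ℂ)] at h5
  have h6 := smul_inj _ _ h5
  rw [hl2] at h6
  linear_combination h6

/-- The coordinates in the joint eigenbasis of `M(b = 1)` and `M(d = 1)`, on the eigenspace `1` of
`M(d = 1)`; here `M(b = 1)` is the element of `𝔏_θ` with `b = 1` and `a = c = d = 0`, and so on. -/
noncomputable def plusPart (u : Fin 4 → ℂ) : Fin 2 → ℂ :=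
  ![(u 0 + u 1 + u 2 + u 3) / 2, (u 0 - u 1 - u 2 + u 3) / 2]

/-- The coordinates in the joint eigenbasis of `M(b = 1)` and `M(d = 1)`, on the eigenspace `-1` of
`M(d = 1)`. -/
noncomputable def minusPart (u : Fin 4 → ℂ) : Fin 2 → ℂ :=
  ![(u 0 - u 1 + u 2 - u 3) / 2, (u 0 + u 1 - u 2 - u 3) / 2]

/-- The element of `𝔏_θ` with the given parameters. -/
noncomputable def elemL (θ : ℝ) (a b c d : ℂ) : Matrix (Fin 4) (Fin 4) ℂ :=
  !![a,                b,          gam θ * c, d;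
     b,                a,          d,         star (gam θ) * c;
     star (gam θ) * c, d,          a,         b;
     d,                gam θ * c,  b,         a]

theorem elemL_mem (θ : ℝ) (a b c d : ℂ) : elemL θ a b c d ∈ graphL θ := ⟨a, b, c, d, rfl⟩

/-- In the joint eigenbasis of `M(b = 1)` and `M(d = 1)` the elements of `𝔏_θ` are block diagonal,
and the blocks are combinations of Pauli matrices. -/
theorem elemL_form (θ : ℝ) (a b c d : ℂ) (u v : Fin 4 → ℂ) :
    star u ⬝ᵥ (elemL θ a b c d *ᵥ v) =
      star (plusPart u) ⬝ᵥ (((a + d) • (1 : Matrix (Fin 2) (Fin 2) ℂ) +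
        (b + c * ((gam θ + star (gam θ)) / 2)) • !![1, 0; 0, -1] +
        (c * ((gam θ - star (gam θ)) / 2)) • !![0, -1; 1, 0]) *ᵥ plusPart v) +
      star (minusPart u) ⬝ᵥ (((a - d) • (1 : Matrix (Fin 2) (Fin 2) ℂ) +
        (-b + c * ((gam θ + star (gam θ)) / 2)) • !![1, 0; 0, -1] +
        (c * ((gam θ - star (gam θ)) / 2)) • !![0, -1; 1, 0]) *ᵥ minusPart v) := by
  simp [elemL, plusPart, minusPart, dotProduct, Matrix.mulVec, Fin.sum_univ_four,
    Fin.sum_univ_two, Complex.conj_ofNat]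
  ring

/-- A two-dimensional code exists for `𝔏_θ` only if `cos (θ / 2) = 0`. -/
theorem gam_add_star_gam_eq_zero_of_conditions {θ : ℝ} {φ ψ : Fin 4 → ℂ}
    (hφ : star φ ⬝ᵥ φ = 1) (hψ : star ψ ⬝ᵥ ψ = 1) (hφψ : star φ ⬝ᵥ ψ = 0)
    (h : ∀ M ∈ graphL θ,
      star φ ⬝ᵥ (M *ᵥ ψ) = 0 ∧ star φ ⬝ᵥ (M *ᵥ φ) = star ψ ⬝ᵥ (M *ᵥ ψ)) :
    gam θ + star (gam θ) = 0 := by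
  set w : Fin 2 → Fin 4 → ℂ := ![φ, ψ] with hw
  set A : Matrix (Fin 2) (Fin 2) ℂ := Matrix.of fun i j => plusPart (w j) i with hA
  set F : Matrix (Fin 2) (Fin 2) ℂ := Matrix.of fun i j => minusPart (w j) i with hF
  set z : Matrix (Fin 2) (Fin 2) ℂ := !![1, 0; 0, -1] with hzdef
  set y : Matrix (Fin 2) (Fin 2) ℂ := !![0, -1; 1, 0] with hydef
  have hψφ : star ψ ⬝ᵥ φ = 0 := by rw [Matrix.star_dotProduct, hφψ, star_zero]
  -- the graph is closed under adjoints, so the conditions are symmetric in `φ` and `ψ`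
  have hconj : ∀ a b c d, star ψ ⬝ᵥ (elemL θ a b c d *ᵥ φ) = 0 := by
    intro a b c d
    have h1 := (h _ (elemL_mem θ (star a) (star b) (star c) (star d))).1
    have h2 : elemL θ (star a) (star b) (star c) (star d) = (elemL θ a b c d)ᴴ := by
      ext i j
      fin_cases i <;> fin_cases j <;> simp [elemL, mul_comm]
    rw [h2, Matrix.dotProduct_mulVec, ← Matrix.star_mulVec] at h1
    rw [Matrix.star_dotProduct, h1, star_zero]
  have hcomp : ∀ a b c d, ∃ r : ℂ, ∀ i j,
      star (w i) ⬝ᵥ (elemL θ a b c d *ᵥ w j) = (r • (1 : Matrix (Fin 2) (Fin 2) ℂ)) i j := by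
    intro a b c d
    obtain ⟨h1, h2⟩ := h _ (elemL_mem θ a b c d)
    refine ⟨star φ ⬝ᵥ (elemL θ a b c d *ᵥ φ), fun i j => ?_⟩
    fin_cases i <;> fin_cases j <;> simp [hw, h1, h2, hconj]
  have entA : ∀ (M : Matrix (Fin 2) (Fin 2) ℂ) i j,
      star (plusPart (w i)) ⬝ᵥ (M *ᵥ plusPart (w j)) = (Aᴴ * M * A) i j := by
    intro M i j
    rw [Matrix.mul_assoc]; rfl
  have entF : ∀ (M : Matrix (Fin 2) (Fin 2) ℂ) i j,
      star (minusPart (w i)) ⬝ᵥ (M *ᵥ minusPart (w j)) = (Fᴴ * M * F) i j := by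
    intro M i j
    rw [Matrix.mul_assoc]; rfl
  have hone : ∀ i j, star (w i) ⬝ᵥ (elemL θ 1 0 0 0 *ᵥ w j) =
      (1 : Matrix (Fin 2) (Fin 2) ℂ) i j := by
    intro i j
    have h1 : elemL θ 1 0 0 0 = 1 := by
      ext i j
      fin_cases i <;> fin_cases j <;> simp [elemL]
    rw [h1, Matrix.one_mulVec]
    fin_cases i <;> fin_cases j <;> simp [hw, hφ, hψ, hφψ, hψφ]
  obtain ⟨d, hd⟩ := hcomp 0 0 0 1
  obtain ⟨b, hb⟩ := hcomp 0 1 0 0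
  obtain ⟨c, hc⟩ := hcomp 0 0 1 0
  simp only [elemL_form, ← hzdef, ← hydef, entA, entF] at hone hd hb hc
  have := eq_zero_of_compressions (A := A) (F := F) (z := z) (y := y)
    (α := (gam θ + star (gam θ)) / 2) (s := (gam θ - star (gam θ)) / 2) (b := b) (c := c) (d := d)
    (by ext i j; fin_cases i <;> fin_cases j <;> simp [hzdef])
    (by ext i j; fin_cases i <;> fin_cases j <;> simp [hzdef, hydef])
    (by simp [hzdef, Matrix.trace_fin_two]) (by simp [hydef, Matrix.trace_fin_two])
    (by ext i j; rw [← hone]; simp)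
    (by ext i j; rw [← hd]; simp [sub_eq_add_neg])
    (by ext i j; rw [← hb]; simp [sub_eq_add_neg])
    (by
      ext i j; rw [← hc]
      simp [Matrix.mul_add, Matrix.add_mul]
      ring)
  linear_combination 2 * this

theorem gam_add_star_gam_ne_zero {θ : ℝ} (hθ : θ ∈ Set.Ioc (-Real.pi) Real.pi)
    (h : θ ≠ Real.pi) : gam θ + star (gam θ) ≠ 0 := by
  have h1 : 0 < Real.cos (θ / 2) := Real.cos_pos_of_mem_Ioo
    ⟨by linarith [hθ.1], by linarith [lt_of_le_of_ne hθ.2 h]⟩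
  rw [gam_add_star_gam]
  exact mul_ne_zero two_ne_zero (by exact_mod_cast h1.ne')

/-- A three-dimensional subspace contains a unit vector satisfying two given linear equations. -/
theorem exists_unit_mem_ker {K : Submodule ℂ (EuclideanSpace ℂ (Fin 4))}
    (hK : 3 ≤ Module.finrank ℂ K) (f : (Fin 4 → ℂ) →ₗ[ℂ] Fin 2 → ℂ) :
    ∃ v : Fin 4 → ℂ, WithLp.toLp 2 v ∈ K ∧ star v ⬝ᵥ v = 1 ∧ f v = 0 := by
  let g : K →ₗ[ℂ] Fin 2 → ℂ := f ∘ₗ (WithLp.linearEquiv 2 ℂ (Fin 4 → ℂ)).toLinearMap ∘ₗ K.subtype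
  have hg : LinearMap.ker g ≠ ⊥ := LinearMap.ker_ne_bot_of_finrank_lt (by
    simpa using Nat.lt_of_succ_le hK)
  obtain ⟨v, hv, hv0⟩ := Submodule.exists_mem_ne_zero_of_ne_bot hg
  have hn : ‖(v : EuclideanSpace ℂ (Fin 4))‖ ≠ 0 := by simpa using hv0
  refine ⟨(((‖(v : EuclideanSpace ℂ (Fin 4))‖⁻¹ : ℝ) : ℂ) • (v : EuclideanSpace ℂ (Fin 4))).ofLp,
    K.smul_mem _ v.2, ?_, ?_⟩
  · rw [← inner_eq_star_dotProduct, inner_self_eq_norm_sq_to_K, norm_smul, Complex.norm_real,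
      norm_inv, norm_norm, inv_mul_cancel₀ hn]
    simp
  · rw [WithLp.ofLp_smul, map_smul]
    have : f (v : EuclideanSpace ℂ (Fin 4)).ofLp = 0 := hv
    rw [this, smul_zero]

/-- A code of dimension three would meet both two-dimensional eigenspaces of `M(b = 1)`, whose
compression to the code is scalar. -/
theorem finrank_code_le_two {β : Type u} [Fintype β] {θ : ℝ}
    {Φ : Matrix (Fin 4) (Fin 4) ℂ →ₗ[ℂ] Matrix β β ℂ} (hΦ : InClassL θ Φ)
    {K : Submodule ℂ (EuclideanSpace ℂ (Fin 4))} (hK : IsErrorCorrectingCode Φ K) :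
    Module.finrank ℂ K ≤ 2 := by
  by_contra hlt
  have h3 : 3 ≤ Module.finrank ℂ K := by omega
  obtain ⟨v, hvK, hv1, hv⟩ := exists_unit_mem_ker h3
    (Matrix.toLin' !![1, -1, 0, 0; 0, 0, 1, -1])
  obtain ⟨w, hwK, hw1, hw⟩ := exists_unit_mem_ker h3
    (Matrix.toLin' !![1, 1, 0, 0; 0, 0, 1, 1])
  have v01 : v 0 = v 1 := by
    have := congrFun hv 0
    simpa [Matrix.mulVec, dotProduct, Fin.sum_univ_four, ← sub_eq_add_neg, sub_eq_zero] using this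
  have v23 : v 2 = v 3 := by
    have := congrFun hv 1
    simpa [Matrix.mulVec, dotProduct, Fin.sum_univ_four, ← sub_eq_add_neg, sub_eq_zero] using this
  have w01 : w 0 = -w 1 := by
    have := congrFun hw 0
    simpa [Matrix.mulVec, dotProduct, Fin.sum_univ_four, add_eq_zero_iff_eq_neg] using this
  have w23 : w 2 = -w 3 := by
    have := congrFun hw 1
    simpa [Matrix.mulVec, dotProduct, Fin.sum_univ_four, add_eq_zero_iff_eq_neg] using this
  have hvw : star v ⬝ᵥ w = 0 := by
    simp only [dotProduct, Fin.sum_univ_four, Pi.star_apply, v01, v23, w01, w23]; ring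
  have hBv : elemL θ 0 1 0 0 *ᵥ v = v := by
    ext i; fin_cases i <;>
      simp [elemL, Matrix.mulVec, dotProduct, Fin.sum_univ_four, v01, v23]
  have hBw : elemL θ 0 1 0 0 *ᵥ w = -w := by
    ext i; fin_cases i <;>
      simp [elemL, Matrix.mulVec, dotProduct, Fin.sum_univ_four, w01, w23]
  have := (hΦ.2.spansGraph.dotProduct_eq hK hvK hwK hv1 hw1 hvw _ (elemL_mem θ 0 1 0 0)).2
  rw [hBv, hBw, dotProduct_neg, hv1, hw1] at this
  norm_num at this

theorem oneShotCapacity_pos_iff {β : Type u} [Fintype β] {θ : ℝ}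
    (hθ : θ ∈ Set.Ioc (-Real.pi) Real.pi)
    {Φ : Matrix (Fin 4) (Fin 4) ℂ →ₗ[ℂ] Matrix β β ℂ} (hΦ : InClassL θ Φ) :
    (0 < oneShotCapacity Φ ↔ θ = Real.pi) ∧ (θ = Real.pi → oneShotCapacity Φ = 1) := by
  have h1 : θ = Real.pi → oneShotCapacity Φ = 1 := by
    rintro rfl
    obtain ⟨K, hK, h2⟩ := isErrorCorrectingCode_pi hΦ
    exact le_antisymm (oneShotCapacity_le_one fun K hK => finrank_code_le_two hΦ hK)
      (le_oneShotCapacity hK h2)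
  refine ⟨⟨fun hpos => ?_, fun h => by rw [h1 h]; exact one_pos⟩, h1⟩
  by_contra hne
  refine hpos.ne' (hΦ.2.spansGraph.oneShotCapacity_eq_zero fun φ ψ hφ hψ hφψ h => ?_)
  exact gam_add_star_gam_ne_zero hθ hne (gam_add_star_gam_eq_zero_of_conditions hφ hψ hφψ h)

end OneChannel

/-! ### Vanishing capacity for small angles -/

section SmallAngles

open scoped Matrix.Norms.L2Operator

theorem norm_dotProduct_mulVec_le {α : Type*} [Fintype α] [DecidableEq α] (N : Matrix α α ℂ)
    {u v : α → ℂ} (hu : star u ⬝ᵥ u = 1) (hv : star v ⬝ᵥ v = 1) :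
    ‖star u ⬝ᵥ (N *ᵥ v)‖ ≤ ‖N‖ := by
  have hn : ∀ u : α → ℂ, star u ⬝ᵥ u = 1 → ‖(WithLp.toLp 2 u : EuclideanSpace ℂ α)‖ = 1 := by
    intro u hu
    have h1 := inner_self_eq_norm_sq_to_K (𝕜 := ℂ) (WithLp.toLp 2 u : EuclideanSpace ℂ α)
    rw [inner_eq_star_dotProduct, hu] at h1
    have h2 : ‖(WithLp.toLp 2 u : EuclideanSpace ℂ α)‖ ^ 2 = 1 := Complex.ofReal_injective (by
      rw [Complex.ofReal_pow, Complex.ofReal_one]; exact h1.symm)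
    exact (pow_eq_one_iff_of_nonneg (norm_nonneg _) two_ne_zero).1 h2
  have h1 := norm_inner_le_norm (𝕜 := ℂ) (WithLp.toLp 2 u : EuclideanSpace ℂ α)
    (WithLp.toLp 2 (N *ᵥ v))
  have h2 := Matrix.l2_opNorm_mulVec N (WithLp.toLp 2 v : EuclideanSpace ℂ α)
  rw [inner_eq_star_dotProduct, hn u hu, one_mul] at h1
  rw [hn v hv, mul_one] at h2
  exact h1.trans h2

theorem norm_diagonal_le {α : Type*} [Fintype α] [DecidableEq α] {v : α → ℂ} {r : ℝ} (hr : 0 ≤ r)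
    (h : ∀ i, ‖v i‖ ≤ r) : ‖(Matrix.diagonal v : Matrix α α ℂ)‖ ≤ r := by
  rw [Matrix.l2_opNorm_diagonal]
  exact (pi_norm_le_iff_of_nonneg hr).2 h

/-- The character table of `(ℤ/2)²`. -/
def hadamard4 : Matrix (Fin 4) (Fin 4) ℂ :=
  !![1,  1,  1,  1;
     1, -1,  1, -1;
     1,  1, -1, -1;
     1, -1, -1,  1]

/-- The difference of the phases of the parameter `c` in `𝔏_θ` and in `𝔏_0`. -/
noncomputable def phaseDefect (θ : ℝ) (p q : Fin 4) : ℂ :=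
  !![0, 0, gam θ - 1, 0;
     0, 0, 0, star (gam θ) - 1;
     star (gam θ) - 1, 0, 0, 0;
     0, gam θ - 1, 0, 0] p q

/-- The nonzero entries of the rows of `phaseDefect`. -/
noncomputable def phaseRow (θ : ℝ) : Fin 4 → ℂ :=
  ![gam θ - 1, star (gam θ) - 1, star (gam θ) - 1, gam θ - 1]

theorem norm_phaseRow (θ : ℝ) (p : Fin 4) : ‖phaseRow θ p‖ = ‖gam θ - 1‖ := by
  have h : ‖star (gam θ) - 1‖ = ‖gam θ - 1‖ := by
    rw [← norm_star (gam θ - 1), star_sub, star_one]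
  fin_cases p <;> simp [phaseRow] <;> simpa using h

/-- The support of `phaseDefect` is a coset pattern, hence an average of products of characters. -/
theorem phaseDefect_eq (θ : ℝ) (p q : Fin 4) :
    phaseDefect θ p q =
      phaseRow θ p * ∑ j, hadamard4 j 2 / 4 * (hadamard4 j p * hadamard4 j q) := by
  fin_cases p <;> fin_cases q <;>
    simp [phaseDefect, phaseRow, hadamard4, Fin.sum_univ_four] <;> norm_num

theorem norm_hadamard4 (i j : Fin 4) : ‖hadamard4 i j‖ = 1 := by
  fin_cases i <;> fin_cases j <;> simp [hadamard4]

variable {n : ℕ}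

/-- Entrywise multiplication by the phase defect in one tensor factor has norm at most
`|γ - 1|`: it is a diagonal matrix times an average of conjugations by diagonal unitaries. -/
theorem norm_phaseDefect_mul_le (θ : ℝ) (k : Fin n)
    (M : Matrix (Fin n → Fin 4) (Fin n → Fin 4) ℂ) :
    ‖(Matrix.of fun p q => phaseDefect θ (p k) (q k) * M p q :
      Matrix (Fin n → Fin 4) (Fin n → Fin 4) ℂ)‖ ≤ ‖gam θ - 1‖ * ‖M‖ := by
  let Z : Fin 4 → Matrix (Fin n → Fin 4) (Fin n → Fin 4) ℂ :=
    fun j => Matrix.diagonal fun p => hadamard4 j (p k)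
  have hZ : ∀ j, ‖Z j‖ ≤ 1 := fun j =>
    norm_diagonal_le zero_le_one fun p => (norm_hadamard4 _ _).le
  have h : (Matrix.of fun p q => phaseDefect θ (p k) (q k) * M p q :
      Matrix (Fin n → Fin 4) (Fin n → Fin 4) ℂ) =
      Matrix.diagonal (fun p => phaseRow θ (p k)) *
        ∑ j, (hadamard4 j 2 / 4) • (Z j * M * Z j) := by
    ext p q
    rw [Matrix.diagonal_mul, Matrix.of_apply, phaseDefect_eq, mul_assoc, Finset.sum_mul,
      Matrix.sum_apply]
    congr 1
    refine Finset.sum_congr rfl fun j _ => ?_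
    simp only [Z, Matrix.smul_apply, Matrix.mul_diagonal, Matrix.diagonal_mul, smul_eq_mul]
    ring
  rw [h]
  refine (Matrix.l2_opNorm_mul _ _).trans ?_
  refine mul_le_mul (norm_diagonal_le (norm_nonneg _) fun p => (norm_phaseRow _ _).le) ?_
    (norm_nonneg _) (norm_nonneg _)
  have hterm : ∀ j, ‖(hadamard4 j 2 / 4) • (Z j * M * Z j)‖ ≤ 1 / 4 * ‖M‖ := by
    intro j
    rw [norm_smul, norm_div, norm_hadamard4]
    have h4 : ‖(4 : ℂ)‖ = 4 := by simp
    rw [h4]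
    refine mul_le_mul_of_nonneg_left ?_ (by norm_num)
    calc ‖Z j * M * Z j‖ ≤ ‖Z j * M‖ * ‖Z j‖ := Matrix.l2_opNorm_mul _ _
      _ ≤ ‖Z j * M‖ * 1 := mul_le_mul_of_nonneg_left (hZ j) (norm_nonneg _)
      _ ≤ ‖Z j‖ * ‖M‖ := by rw [mul_one]; exact Matrix.l2_opNorm_mul _ _
      _ ≤ 1 * ‖M‖ := mul_le_mul_of_nonneg_right (hZ j) (norm_nonneg _)
      _ = ‖M‖ := one_mul _
  calc _ ≤ ∑ j, ‖(hadamard4 j 2 / 4) • (Z j * M * Z j)‖ := norm_sum_le _ _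
    _ ≤ ∑ _j : Fin 4, 1 / 4 * ‖M‖ := Finset.sum_le_sum fun j _ => hterm j
    _ = ‖M‖ := by simp

/-- The deformation from `𝔏_0 ⊗ … ⊗ 𝔏_0` to `𝔏_{θ₁} ⊗ … ⊗ 𝔏_{θₙ}`, restricted to the tensor
factors in `s`; it is entrywise multiplication by phases. -/
noncomputable def deform (θ : Fin n → ℝ) (s : Finset (Fin n)) :
    Matrix (Fin n → Fin 4) (Fin n → Fin 4) ℂ →ₗ[ℂ]
      Matrix (Fin n → Fin 4) (Fin n → Fin 4) ℂ where
  toFun M := Matrix.of fun p q => (∏ k ∈ s, (1 + phaseDefect (θ k) (p k) (q k))) * M p q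
  map_add' M N := by ext; simp [mul_add]
  map_smul' c M := by ext; simp [mul_left_comm]

theorem norm_deform_sub_le (θ : Fin n → ℝ) (s : Finset (Fin n))
    (M : Matrix (Fin n → Fin 4) (Fin n → Fin 4) ℂ) :
    ‖deform θ s M - M‖ ≤ (∏ k ∈ s, (1 + ‖gam (θ k) - 1‖) - 1) * ‖M‖ := by
  classical
  induction s using Finset.induction_on with
  | empty =>
    have : deform θ ∅ M = M := by ext; simp [deform]
    simp [this]
  | insert k s hk ih =>
    have h1 : deform θ (insert k s) M - M =
        (Matrix.of fun p q => phaseDefect (θ k) (p k) (q k) * deform θ s M p q) +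
          (deform θ s M - M) := by
      ext p q
      simp only [deform, LinearMap.coe_mk, AddHom.coe_mk, Matrix.sub_apply, Matrix.add_apply,
        Matrix.of_apply, Finset.prod_insert hk]
      ring
    have h2 : ‖deform θ s M‖ ≤ (∏ k ∈ s, (1 + ‖gam (θ k) - 1‖)) * ‖M‖ := by
      calc ‖deform θ s M‖ = ‖(deform θ s M - M) + M‖ := by rw [sub_add_cancel]
        _ ≤ ‖deform θ s M - M‖ + ‖M‖ := norm_add_le _ _
        _ ≤ _ := by linarith
    rw [h1, Finset.prod_insert hk]
    refine (norm_add_le _ _).trans ?_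
    have h3 := norm_phaseDefect_mul_le (θ k) k (deform θ s M)
    have h4 := mul_le_mul_of_nonneg_left h2 (norm_nonneg (gam (θ k) - 1))
    calc _ ≤ ‖gam (θ k) - 1‖ * ((∏ k ∈ s, (1 + ‖gam (θ k) - 1‖)) * ‖M‖) +
          (∏ k ∈ s, (1 + ‖gam (θ k) - 1‖) - 1) * ‖M‖ := add_le_add (h3.trans h4) ih
      _ = _ := by ring

/-- The minimal projections of the commutative algebra `𝔏_0`. -/
noncomputable def charProj (j : Fin 4) : Matrix (Fin 4) (Fin 4) ℂ :=
  Matrix.of fun p q => hadamard4 j p * hadamard4 j q / 4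

theorem deform_charProj_mem_graphL (θ : ℝ) (j : Fin 4) :
    (Matrix.of fun p q => (1 + phaseDefect θ p q) * charProj j p q) ∈ graphL θ := by
  refine ⟨1 / 4, hadamard4 j 1 / 4, hadamard4 j 2 / 4, hadamard4 j 3 / 4, ?_⟩
  ext p q
  fin_cases j <;> fin_cases p <;> fin_cases q <;>
    simp [phaseDefect, charProj, hadamard4]

theorem deform_tensor_charProj (θ : Fin n → ℝ) (i : Fin n → Fin 4) :
    ∃ M : Fin n → Matrix (Fin 4) (Fin 4) ℂ, (∀ k, M k ∈ graphL (θ k)) ∧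
      deform θ Finset.univ (tensorMatrix fun k => charProj (i k)) = tensorMatrix M := by
  refine ⟨fun k => Matrix.of fun p q => (1 + phaseDefect (θ k) p q) * charProj (i k) p q,
    fun k => deform_charProj_mem_graphL _ _, ?_⟩
  ext p q
  simp [deform, tensorMatrix, Finset.prod_mul_distrib]

/-- The unitary matrix of the Fourier transform on the `n`-fold power of `(ℤ/2)²`. -/
noncomputable def fourier (n : ℕ) : Matrix (Fin n → Fin 4) (Fin n → Fin 4) ℂ :=
  tensorMatrix fun _ => (1 / 2 : ℂ) • hadamard4

theorem fourier_conjTranspose : (fourier n)ᴴ = fourier n := by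
  have h : ((1 / 2 : ℂ) • hadamard4)ᴴ = (1 / 2 : ℂ) • hadamard4 := by
    ext i j
    fin_cases i <;> fin_cases j <;> simp [hadamard4]
  rw [fourier, tensorMatrix_conjTranspose, h]

theorem fourier_mul_fourier : fourier n * fourier n = 1 := by
  have h : ((1 / 2 : ℂ) • hadamard4) * ((1 / 2 : ℂ) • hadamard4) = 1 := by
    ext i j
    fin_cases i <;> fin_cases j <;>
      simp [hadamard4, Matrix.mul_apply, Fin.sum_univ_four] <;> norm_num
  rw [fourier, tensorMatrix_mul]
  simp only [h, tensorMatrix_one]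

theorem norm_fourier_le : ‖fourier n‖ ≤ 1 := by
  have h := Matrix.l2_opNorm_conjTranspose_mul_self (fourier n)
  rw [fourier_conjTranspose, fourier_mul_fourier] at h
  have h1 : ‖(1 : Matrix (Fin n → Fin 4) (Fin n → Fin 4) ℂ)‖ ≤ 1 := by
    rw [← Matrix.diagonal_one]
    exact norm_diagonal_le zero_le_one fun i => by simp
  nlinarith [norm_nonneg (fourier n)]

/-- The operator with eigenvalues `m` in the Fourier basis. -/
noncomputable def spectralOp (m : (Fin n → Fin 4) → ℂ) :
    Matrix (Fin n → Fin 4) (Fin n → Fin 4) ℂ :=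
  fourier n * Matrix.diagonal m * fourier n

theorem norm_spectralOp_le {m : (Fin n → Fin 4) → ℂ} (hm : ∀ i, ‖m i‖ ≤ 1) :
    ‖spectralOp m‖ ≤ 1 := by
  have h1 := norm_diagonal_le zero_le_one hm
  have h2 := norm_fourier_le (n := n)
  calc ‖spectralOp m‖ ≤ ‖fourier n * Matrix.diagonal m‖ * ‖fourier n‖ := Matrix.l2_opNorm_mul _ _
    _ ≤ (‖fourier n‖ * ‖(Matrix.diagonal m : Matrix (Fin n → Fin 4) (Fin n → Fin 4) ℂ)‖) *
        ‖fourier n‖ := mul_le_mul_of_nonneg_right (Matrix.l2_opNorm_mul _ _) (norm_nonneg _)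
    _ ≤ (1 * 1) * 1 := by gcongr
    _ = 1 := by norm_num

theorem spectralOp_eq_sum (m : (Fin n → Fin 4) → ℂ) :
    spectralOp m = ∑ i, m i • tensorMatrix fun k => charProj (i k) := by
  have hsymm : ∀ i j, hadamard4 i j = hadamard4 j i := by
    intro i j
    fin_cases i <;> fin_cases j <;> simp [hadamard4]
  ext p q
  rw [spectralOp, Matrix.mul_apply, Matrix.sum_apply]
  refine Finset.sum_congr rfl fun i _ => ?_
  rw [Matrix.mul_diagonal, Matrix.smul_apply, smul_eq_mul, mul_right_comm, mul_comm]
  congr 1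
  simp only [fourier, tensorMatrix, Matrix.of_apply, ← Finset.prod_mul_distrib]
  refine Finset.prod_congr rfl fun k _ => ?_
  simp only [charProj, Matrix.of_apply, Matrix.smul_apply, smul_eq_mul, hsymm (p k)]
  ring

theorem spectralOp_form (m : (Fin n → Fin 4) → ℂ) (u v : (Fin n → Fin 4) → ℂ) :
    star u ⬝ᵥ (spectralOp m *ᵥ v) =
      ∑ i, m i * (star ((fourier n *ᵥ u) i) * (fourier n *ᵥ v) i) := by
  rw [spectralOp, Matrix.mul_assoc, ← Matrix.mulVec_mulVec, Matrix.dotProduct_mulVec]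
  nth_rewrite 1 [← fourier_conjTranspose]
  rw [← Matrix.star_mulVec, ← Matrix.mulVec_mulVec]
  refine Finset.sum_congr rfl fun i _ => ?_
  rw [Matrix.mulVec_diagonal, Pi.star_apply]
  ring

theorem sum_norm_sq_fourier {u : (Fin n → Fin 4) → ℂ} (hu : star u ⬝ᵥ u = 1) :
    ∑ i, ‖(fourier n *ᵥ u) i‖ ^ 2 = 1 := by
  have h := spectralOp_form (fun _ => 1) u u
  have h1 : spectralOp (n := n) (fun _ => 1) = 1 := by
    rw [spectralOp, Matrix.diagonal_one, Matrix.mul_one, fourier_mul_fourier]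
  rw [h1, Matrix.one_mulVec, hu] at h
  have h2 : ((∑ i, ‖(fourier n *ᵥ u) i‖ ^ 2 : ℝ) : ℂ) = 1 := by
    rw [h]; push_cast
    refine Finset.sum_congr rfl fun i _ => ?_
    rw [one_mul, Complex.star_def, Complex.conj_mul']
  exact_mod_cast h2

theorem prod_one_add_norm_gam_sub_one_lt {θ : Fin n → ℝ}
    (h : ∑ k, |θ k| ≤ 2 * Real.log (3 / 2)) : ∏ k, (1 + ‖gam (θ k) - 1‖) < 3 / 2 := by
  have hle : ∀ k, 1 + ‖gam (θ k) - 1‖ ≤ 1 + |θ k| / 2 := by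
    intro k
    have h1 := Real.norm_exp_I_mul_ofReal_sub_one_le (x := θ k / 2)
    have h2 : Complex.I * ((θ k / 2 : ℝ) : ℂ) = Complex.I / 2 * θ k := by push_cast; ring
    rw [h2, Real.norm_eq_abs, abs_div, abs_two] at h1
    exact add_le_add_right h1 1
  have hpos : ∀ k, 0 < 1 + ‖gam (θ k) - 1‖ := fun k => by positivity
  by_cases h0 : ∀ k, θ k = 0
  · simp [h0, gam]; norm_num
  · push Not at h0
    obtain ⟨k, hk⟩ := h0
    calc ∏ k, (1 + ‖gam (θ k) - 1‖) < ∏ k, Real.exp (|θ k| / 2) := by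
          refine Finset.prod_lt_prod (fun i _ => hpos i) (fun i _ => (hle i).trans ?_)
            ⟨k, Finset.mem_univ k, (hle k).trans_lt ?_⟩
          · rw [add_comm]; exact Real.add_one_le_exp _
          · rw [add_comm]; exact Real.add_one_lt_exp (by simpa using hk)
      _ = Real.exp ((∑ k, |θ k|) / 2) := by rw [← Real.exp_sum, Finset.sum_div]
      _ ≤ Real.exp (Real.log (3 / 2)) := Real.exp_le_exp.2 (by linarith)
      _ = 3 / 2 := Real.exp_log (by norm_num)

/-- In the Fourier basis the overlap `∑ |φ̂||ψ̂|` and half of the distance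
`∑ ||φ̂|² - |ψ̂|²|` of the distributions add up to at least one. Both are values of operators of
norm one from `𝔏_0 ⊗ … ⊗ 𝔏_0`, and both vanish on the deformed operators, so they are bounded by
the distance that the deformation moves an operator of norm one. -/
theorem one_le_of_conditions {θ : Fin n → ℝ} {φ ψ : (Fin n → Fin 4) → ℂ}
    (hφ : star φ ⬝ᵥ φ = 1) (hψ : star ψ ⬝ᵥ ψ = 1)
    (h : ∀ M : Fin n → Matrix (Fin 4) (Fin 4) ℂ, (∀ k, M k ∈ graphL (θ k)) →
      star φ ⬝ᵥ (tensorMatrix M *ᵥ ψ) = 0 ∧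
        star φ ⬝ᵥ (tensorMatrix M *ᵥ φ) = star ψ ⬝ᵥ (tensorMatrix M *ᵥ ψ)) :
    1 ≤ 2 * (∏ k, (1 + ‖gam (θ k) - 1‖) - 1) := by
  set δ := ∏ k, (1 + ‖gam (θ k) - 1‖) - 1 with hδ
  have hδ0 : 0 ≤ δ := sub_nonneg.2 (by
    simpa using Finset.prod_le_prod (s := Finset.univ) (f := fun _ : Fin n => (1 : ℝ))
      (g := fun k => 1 + ‖gam (θ k) - 1‖) (fun _ _ => zero_le_one) (fun k _ => by simp))
  set T := deform θ Finset.univ with hT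
  have hTM : ∀ m : (Fin n → Fin 4) → ℂ, star φ ⬝ᵥ (T (spectralOp m) *ᵥ ψ) = 0 ∧
      star φ ⬝ᵥ (T (spectralOp m) *ᵥ φ) = star ψ ⬝ᵥ (T (spectralOp m) *ᵥ ψ) := by
    intro m
    have key : ∀ i : Fin n → Fin 4, star φ ⬝ᵥ (T (tensorMatrix fun k => charProj (i k)) *ᵥ ψ) = 0 ∧
        star φ ⬝ᵥ (T (tensorMatrix fun k => charProj (i k)) *ᵥ φ) =
          star ψ ⬝ᵥ (T (tensorMatrix fun k => charProj (i k)) *ᵥ ψ) := by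
      intro i
      obtain ⟨M, hM, hTi⟩ := deform_tensor_charProj θ i
      rw [hT, hTi]
      exact h M hM
    rw [spectralOp_eq_sum, map_sum]
    simp only [map_smul, Matrix.sum_mulVec, dotProduct_sum, Matrix.smul_mulVec, dotProduct_smul,
      (key _).1, (key _).2, smul_zero, Finset.sum_const_zero, and_self]
  have hnorm : ∀ m : (Fin n → Fin 4) → ℂ, (∀ i, ‖m i‖ ≤ 1) →
      ‖T (spectralOp m) - spectralOp m‖ ≤ δ := fun m hm =>
    (norm_deform_sub_le θ Finset.univ _).trans
      ((mul_le_mul_of_nonneg_left (norm_spectralOp_le hm) hδ0).trans_eq (mul_one _))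
  set x := fourier n *ᵥ φ with hx
  set y := fourier n *ᵥ ψ with hy
  have hs : ∑ i, ‖x i‖ * ‖y i‖ ≤ δ := by
    set m : (Fin n → Fin 4) → ℂ :=
      fun i => star (star (x i) * y i) / (‖star (x i) * y i‖ : ℂ) with hmdef
    have hm : ∀ i, ‖m i‖ ≤ 1 := by
      intro i
      simp only [hmdef, norm_div, norm_star, Complex.norm_real, norm_norm]
      exact div_self_le_one _
    have h1 : star φ ⬝ᵥ (spectralOp m *ᵥ ψ) = ((∑ i, ‖x i‖ * ‖y i‖ : ℝ) : ℂ) := by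
      rw [spectralOp_form]
      push_cast
      refine Finset.sum_congr rfl fun i _ => ?_
      have e : (‖x i‖ : ℂ) * ‖y i‖ = (‖star (x i) * y i‖ : ℂ) := by
        rw [norm_mul, norm_star]; push_cast; rfl
      rw [e]
      change star (star (x i) * y i) / _ * (star (x i) * y i) = _
      rw [div_mul_eq_mul_div, Complex.star_def, Complex.conj_mul', sq, mul_self_div_self]
    have h2 := norm_dotProduct_mulVec_le (T (spectralOp m) - spectralOp m) hφ hψ
    rw [Matrix.sub_mulVec, dotProduct_sub, (hTM m).1, zero_sub, norm_neg, h1,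
      Complex.norm_of_nonneg (Finset.sum_nonneg fun i _ => by positivity)] at h2
    exact h2.trans (hnorm m hm)
  have ht : ∑ i, |‖x i‖ ^ 2 - ‖y i‖ ^ 2| ≤ 2 * δ := by
    set m : (Fin n → Fin 4) → ℂ :=
      fun i => ((SignType.sign (‖x i‖ ^ 2 - ‖y i‖ ^ 2) : ℝ) : ℂ) with hmdef
    have hm : ∀ i, ‖m i‖ ≤ 1 := by
      intro i
      simp only [hmdef, Complex.norm_real]
      rcases lt_trichotomy (‖x i‖ ^ 2 - ‖y i‖ ^ 2) 0 with h | h | h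
      · simp [sign_neg h]
      · simp [h]
      · simp [sign_pos h]
    have h1 : star φ ⬝ᵥ (spectralOp m *ᵥ φ) - star ψ ⬝ᵥ (spectralOp m *ᵥ ψ) =
        ((∑ i, |‖x i‖ ^ 2 - ‖y i‖ ^ 2| : ℝ) : ℂ) := by
      rw [spectralOp_form, spectralOp_form, ← Finset.sum_sub_distrib]
      push_cast
      refine Finset.sum_congr rfl fun i _ => ?_
      rw [← sign_mul_self]
      simp only [Complex.star_def, ← hx, ← hy, Complex.conj_mul', hmdef]
      push_cast; ring
    have h2 := norm_dotProduct_mulVec_le (T (spectralOp m) - spectralOp m) hφ hφ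
    have h3 := norm_dotProduct_mulVec_le (T (spectralOp m) - spectralOp m) hψ hψ
    have h4 := hnorm m hm
    have h5 : ((∑ i, |‖x i‖ ^ 2 - ‖y i‖ ^ 2| : ℝ) : ℂ) =
        star ψ ⬝ᵥ ((T (spectralOp m) - spectralOp m) *ᵥ ψ) -
          star φ ⬝ᵥ ((T (spectralOp m) - spectralOp m) *ᵥ φ) := by
      rw [← h1]
      simp only [Matrix.sub_mulVec, dotProduct_sub, (hTM m).2]
      ring
    have h6 := congrArg norm h5
    rw [Complex.norm_of_nonneg (Finset.sum_nonneg fun i _ => abs_nonneg _)] at h6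
    rw [h6]
    refine (norm_sub_le _ _).trans ?_
    linarith
  have hpt : ∀ i, ‖x i‖ ^ 2 + ‖y i‖ ^ 2 ≤ 2 * (‖x i‖ * ‖y i‖) + |‖x i‖ ^ 2 - ‖y i‖ ^ 2| := by
    intro i
    rcases le_total ‖x i‖ ‖y i‖ with hxy | hxy
    · nlinarith [neg_abs_le (‖x i‖ ^ 2 - ‖y i‖ ^ 2), norm_nonneg (x i)]
    · nlinarith [le_abs_self (‖x i‖ ^ 2 - ‖y i‖ ^ 2), norm_nonneg (y i)]
  have hsum := Finset.sum_le_sum fun i (_ : i ∈ Finset.univ) => hpt i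
  rw [Finset.sum_add_distrib, Finset.sum_add_distrib, ← Finset.mul_sum, sum_norm_sq_fourier hφ,
    sum_norm_sq_fourier hψ] at hsum
  linarith

theorem oneShotCapacity_tensorChannel_eq_zero {θ : Fin n → ℝ} {β : Fin n → Type u}
    [∀ k, Fintype (β k)] {Φ : ∀ k, Matrix (Fin 4) (Fin 4) ℂ →ₗ[ℂ] Matrix (β k) (β k) ℂ}
    (hΦ : ∀ k, InClassL (θ k) (Φ k)) (h : ∑ k, |θ k| ≤ 2 * Real.log (3 / 2)) :
    oneShotCapacity (tensorChannel Φ) = 0 := by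
  refine (SpansGraph.tensorChannel fun k => (hΦ k).2.spansGraph).oneShotCapacity_eq_zero
    fun φ ψ hφ hψ _ hS => ?_
  have h1 := one_le_of_conditions hφ hψ fun M hM => hS _ ⟨M, hM, rfl⟩
  linarith [prod_one_add_norm_gam_sub_one_lt h]

end SmallAngles

end QZero

theorem theorem1 :
    -- Part A
    (∀ (θ : ℝ), θ ∈ Set.Ioc (-Real.pi) Real.pi →
      ∀ (β : Type u) [Fintype β] (Φ : Matrix (Fin 4) (Fin 4) ℂ →ₗ[ℂ] Matrix β β ℂ),
        QZero.InClassL θ Φ →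
          (0 < QZero.oneShotCapacity Φ ↔ θ = Real.pi) ∧
          (θ = Real.pi → QZero.oneShotCapacity Φ = 1)) ∧
    -- Parts B and C
    (∀ (n : ℕ) (θ : Fin n → ℝ), (∀ k, θ k ∈ Set.Ioc (-Real.pi) Real.pi) →
      ∀ (β : Fin n → Type u) [∀ k, Fintype (β k)]
        (Φ : ∀ k, Matrix (Fin 4) (Fin 4) ℂ →ₗ[ℂ] Matrix (β k) (β k) ℂ),
        (∀ k, QZero.InClassL (θ k) (Φ k)) →
          ((∃ m : ℤ, ∑ k, θ k = Real.pi + 2 * Real.pi * m) →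
            0 < QZero.oneShotCapacity (QZero.tensorChannel Φ) ∧
            (∀ x : Fin n → Fin 2,
              QZero.IsErrorCorrectingCode (QZero.tensorChannel Φ) (QZero.code x) ∧
              Module.finrank ℂ (QZero.code x) = 2) ∧
            (∀ x y : Fin n → Fin 2, x ≠ y → QZero.code x ⟂ QZero.code y)) ∧
          (∑ k, |θ k| ≤ 2 * Real.log (3 / 2) →
            QZero.oneShotCapacity (QZero.tensorChannel Φ) = 0)) := by
  refine ⟨fun θ hθ β _ Φ hΦ => QZero.oneShotCapacity_pos_iff hθ hΦ,
    fun n θ _ β _ Φ hΦ => ⟨fun hsum => ?_, QZero.oneShotCapacity_tensorChannel_eq_zero hΦ⟩⟩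
  have hgam := QZero.gam_add_star_gam_eq_zero hsum
  have hcode := QZero.isErrorCorrectingCode_code hΦ hgam
  exact ⟨one_pos.trans_le (QZero.le_oneShotCapacity (hcode 0).1 (hcode 0).2), hcode,
    fun x y hxy => QZero.code_isOrtho hgam hxy⟩
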